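/- Let $\varphi:(0,\infty)\to(0,\infty)$ satisfy: (i) $\varphi\in C^1((0,\infty))$; (ii) $(s\varphi(s))'>0$ for all $s>0$; (iii) the range of $s\mapsto s\varphi(s)$ on $(0,\infty)$ is $(0,\infty)$; (iv) there are $s_0>0$, $C_1,C_2>0$ and $r>-1$ with $C_1s^r\le(s\varphi(s))'\le C_2s^r$ for $s\in(0,s_0)$, and, if $r=0$, moreover $\lim_{s\to0^+}\varphi(s)$ exists, is finite and positive, and $\lim_{s\to0^+}s\varphi'(s)=0$; (v) there is $s_1>s_0$ such that either $\varphi'(s)\ge0$ for all $s\ge s_1$ or $\varphi'(s)\le0$ for all $s\ge s_1$; (vi) $|s\varphi'(s)/\varphi(s)|$ is non-decreasing on $(0,\infty)$. Define $\Lambda$ on $(0,\infty)$ by $$\Lambda\bigl(s\sqrt{\varphi(s)}\bigr)=-\frac{s\varphi'(s)}{s\varphi'(s)+2\varphi(s)}\quad(s>0),\qquad \Lambda_\infty=\lim_{t\to\infty}\Lambda(t).$$ Let $\Omega\subset\mathbb R^n$ be a domain (open and connected), $m\ge1$. A system $\partial_h(\mathscr A^{hk}\partial_k)$ with $m\times m$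 complex matrix coefficients with entries in $L^1_{\mathrm{loc}}(\Omega)$ (sums over $h,k=1,\dots,n$) is called $L^\Phi$-dissipative if $$\operatorname{Re}\int_\Omega\sum_{h,k}\langle\mathscr A^{hk}\partial_ku,\partial_h(\varphi(|u|)u)\rangle\,dx\ge0$$ for all $u\in[C_0^1(\Omega)]^m$ ($\mathbb C^m$-valued, $C^1$, compactly supported in $\Omega$) such that $\varphi(|u|)u\in[C^1_0(\Omega)]^m$, where $\varphi(|u|)u$ is read as $0$ where $u=0$. Let $\mathscr A^h$ ($h=1,\dots,n$) be real $m\times m$ matrix functions on $\Omega$ with entries in $L^1_{\mathrm{loc}}(\Omega)$ such that, for almost every $x\in\Omega$, $\mathscr A^h(x)$ is symmetric and $\langle\mathscr A^h(x)\xi,\xi\rangle>0$ for every $\xi\in\mathbb R^m\setminus\{0\}$. Let $\mu_1^h(x)$ and $\mu_m^h(x)$ be the smallest and the largest eigenvalue of $\mathscr A^h(x)$. Then the operator $Au=\sum_h\partial_h(\mathscr A^h\partial_hu)$ is $L^\Phi$-dissipative if and only if $$\Lambda_\infty^2\,(\mu_1^h(x)+\mu_m^h(x))^2\le4\,\mu_1^h(x)\,\mu_m^h(x)\qquad\text{for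 almost every }x\in\Omega,\ h=1,\dots,n.$$ If $m=2$, this condition is equivalent to $$\Lambda_\infty^2\,(\operatorname{tr}\mathscr A^h(x))^2\le4\det\mathscr A^h(x)\qquad\text{for almost every }x\in\Omega,\ h=1,\dots,n.$$ -/

import Mathlib

open MeasureTheory Set Filter Topology

noncomputable section

namespace FunctionalDissipativity

/-- The standing conditions on the positive function `φ` on `(0, ∞)`.
Only the values of `φ` on `(0, ∞)` matter. -/
structure Admissible (φ : ℝ → ℝ) : Prop where
  pos : ∀ s, 0 < s → 0 < φ s
  contDiffOn : ContDiffOn ℝ 1 φ (Ioi 0)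
  deriv_pos : ∀ s, 0 < s → 0 < deriv (fun t => t * φ t) s
  range_eq : (fun s => s * φ s) '' Ioi 0 = Ioi 0
  growth : ∃ s₀ : ℝ, 0 < s₀ ∧
    (∃ C₁ C₂ r : ℝ, 0 < C₁ ∧ 0 < C₂ ∧ -1 < r ∧
      (∀ s ∈ Ioo 0 s₀, C₁ * s ^ r ≤ deriv (fun t => t * φ t) s ∧
        deriv (fun t => t * φ t) s ≤ C₂ * s ^ r) ∧
      (r = 0 → (∃ φ₀ : ℝ, 0 < φ₀ ∧ Tendsto φ (𝓝[>] 0) (𝓝 φ₀)) ∧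
        Tendsto (fun s => s * deriv φ s) (𝓝[>] 0) (𝓝 0))) ∧
    (∃ s₁ : ℝ, s₀ < s₁ ∧
      ((∀ s, s₁ ≤ s → 0 ≤ deriv φ s) ∨ (∀ s, s₁ ≤ s → deriv φ s ≤ 0)))
  monotone_abs : MonotoneOn (fun s => |s * deriv φ s / φ s|) (Ioi 0)

/-- The inverse of `s ↦ s √(φ s)` on `(0, ∞)`. -/
def radius (φ : ℝ → ℝ) (t : ℝ) : ℝ :=
  Function.invFunOn (fun s => s * √(φ s)) (Ioi 0) t

/-- The function `Λ` on `(0, ∞)` determined by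
`Λ (s √(φ s)) = - s φ'(s) / (s φ'(s) + 2 φ(s))` for `s > 0`. -/
def Lam (φ : ℝ → ℝ) (t : ℝ) : ℝ :=
  -(radius φ t * deriv φ (radius φ t) /
    (radius φ t * deriv φ (radius φ t) + 2 * φ (radius φ t)))

/-- `Λ_∞ = lim_{t → ∞} Λ(t)`; the limit exists by `tendsto_Lam`. -/
def LamInf (φ : ℝ → ℝ) : ℝ := limUnder atTop (Lam φ)

/-- The partial derivative `∂_k u`. -/
def pderiv {n m : ℕ} (k : Fin n)
    (u : EuclideanSpace ℝ (Fin n) → EuclideanSpace ℂ (Fin m)) (x : EuclideanSpace ℝ (Fin n)) :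
    EuclideanSpace ℂ (Fin m) :=
  fderiv ℝ u x (EuclideanSpace.single k 1)

/-- The space `[C₀¹(Ω)]^m` of `ℂ^m`-valued `C¹` functions with compact support in `Ω`
(extended by zero to the whole space). -/
def IsTest {n m : ℕ} (Ω : Set (EuclideanSpace ℝ (Fin n)))
    (u : EuclideanSpace ℝ (Fin n) → EuclideanSpace ℂ (Fin m)) : Prop :=
  ContDiff ℝ 1 u ∧ HasCompactSupport u ∧ tsupport u ⊆ Ω

/-- The function `φ(|u|) u`, which is zero where `u` vanishes. -/
def phiMul {n m : ℕ} (φ : ℝ → ℝ)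
    (u : EuclideanSpace ℝ (Fin n) → EuclideanSpace ℂ (Fin m)) (x : EuclideanSpace ℝ (Fin n)) :
    EuclideanSpace ℂ (Fin m) :=
  φ ‖u x‖ • u x

/-- `L^Φ`-dissipativity of the system `∂_h (𝒜^{hk} ∂_k)` in `Ω`:
`Re ∫_Ω ∑_{h,k} ⟨𝒜^{hk} ∂_k u, ∂_h (φ(|u|) u)⟩ dx ≥ 0` for all `u ∈ [C₀¹(Ω)]^m` such that
`φ(|u|) u ∈ [C₀¹(Ω)]^m`. The product `⟨a, b⟩ = ∑ᵢ aᵢ conj bᵢ` is linear in the first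
entry, hence it is Mathlib's `inner ℂ b a`. -/
def LPhiDissipative {n m : ℕ} (φ : ℝ → ℝ) (Ω : Set (EuclideanSpace ℝ (Fin n)))
    (𝒜 : Fin n → Fin n → EuclideanSpace ℝ (Fin n) → Matrix (Fin m) (Fin m) ℂ) : Prop :=
  ∀ u : EuclideanSpace ℝ (Fin n) → EuclideanSpace ℂ (Fin m),
    IsTest Ω u → IsTest Ω (phiMul φ u) →
    0 ≤ (∫ x in Ω, ∑ h, ∑ k,
      inner ℂ (pderiv h (phiMul φ u) x)
        (WithLp.toLp 2 ((𝒜 h k x).mulVec (WithLp.ofLp (pderiv k u x))))).re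

/-- The coefficients `𝒜^{hk} = δ_{hk} A^h` of the operator `∂_h (A^h ∂_h)` with real
matrices `A^h`, regarded as a system with complex coefficients. -/
def diagCoeff {n m : ℕ}
    (A : Fin n → EuclideanSpace ℝ (Fin n) → Matrix (Fin m) (Fin m) ℝ) :
    Fin n → Fin n → EuclideanSpace ℝ (Fin n) → Matrix (Fin m) (Fin m) ℂ :=
  fun h k x => if h = k then (A h x).map Complex.ofReal else 0

/-- The smallest eigenvalue of a real symmetric matrix of positive size. -/
def minEigenvalue {m : ℕ} (M : Matrix (Fin m) (Fin m) ℝ) : ℝ :=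
  sInf {μ : ℝ | Module.End.HasEigenvalue (Matrix.toLin' M) μ}

/-- The largest eigenvalue of a real symmetric matrix of positive size. -/
def maxEigenvalue {m : ℕ} (M : Matrix (Fin m) (Fin m) ℝ) : ℝ :=
  sSup {μ : ℝ | Module.End.HasEigenvalue (Matrix.toLin' M) μ}

/-! ### `Λ` and `Λ_∞` are well defined -/

theorem Admissible.strictMonoOn {φ : ℝ → ℝ} (hφ : Admissible φ) :
    StrictMonoOn (fun s => s * √(φ s)) (Ioi 0) := by
  have h1 : StrictMonoOn (fun s => s * φ s) (Ioi 0) := by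
    apply strictMonoOn_of_deriv_pos (convex_Ioi 0)
    · exact continuousOn_id.mul hφ.contDiffOn.continuousOn
    · intro s hs
      rw [interior_Ioi] at hs
      exact hφ.deriv_pos s hs
  intro s hs t ht hst
  have hs' : 0 < s := hs
  have ht' : 0 < t := ht
  have h2 : s * φ s < t * φ t := h1 hs ht hst
  have h3 := hφ.pos s hs
  have h4 := hφ.pos t ht
  show s * √(φ s) < t * √(φ t)
  apply lt_of_pow_lt_pow_left₀ 2 (by positivity)
  rw [mul_pow, mul_pow, Real.sq_sqrt h3.le, Real.sq_sqrt h4.le]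
  have h5 : s * (s * φ s) < t * (t * φ t) := by
    have := mul_pos hs' h3
    nlinarith
  nlinarith

theorem Admissible.surjOn {φ : ℝ → ℝ} (hφ : Admissible φ) :
    SurjOn (fun s => s * √(φ s)) (Ioi 0) (Ioi 0) := by
  have h1 : StrictMonoOn (fun s => s * φ s) (Ioi 0) := by
    apply strictMonoOn_of_deriv_pos (convex_Ioi 0)
    · exact continuousOn_id.mul hφ.contDiffOn.continuousOn
    · intro s hs
      rw [interior_Ioi] at hs
      exact hφ.deriv_pos s hs
  have hone : (1 : ℝ) ∈ Ioi (0 : ℝ) := by simp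
  have hφ1 := hφ.pos 1 one_pos
  intro t ht
  have ht' : 0 < t := ht
  have hsq : ∀ s, 0 < s → (s * √(φ s)) ^ 2 = s * (s * φ s) := by
    intro s hs
    rw [mul_pow, Real.sq_sqrt (hφ.pos s hs).le]
    ring
  obtain ⟨a, ha, hae⟩ : min (t ^ 2) (φ 1) ∈ (fun s => s * φ s) '' Ioi 0 := by
    rw [hφ.range_eq]; exact lt_min (by positivity) hφ1
  obtain ⟨b, hb, hbe⟩ : max (t ^ 2) (φ 1) ∈ (fun s => s * φ s) '' Ioi 0 := by
    rw [hφ.range_eq]; exact lt_max_of_lt_right hφ1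
  have ha0 : 0 < a := ha
  have hb0 : 0 < b := hb
  simp only at hae hbe
  have ha1 : a ≤ 1 := by
    rw [← h1.le_iff_le ha hone]
    simp only [hae, one_mul]
    exact min_le_right _ _
  have hb1 : 1 ≤ b := by
    rw [← h1.le_iff_le hone hb]
    simp only [hbe, one_mul]
    exact le_max_right _ _
  have hga : a * √(φ a) ≤ t := by
    apply le_of_sq_le_sq _ ht'.le
    rw [hsq a ha0]
    have h2 : a * φ a ≤ t ^ 2 := hae ▸ min_le_left _ _
    have h3 : 0 < a * φ a := mul_pos ha0 (hφ.pos a ha0)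
    nlinarith
  have hgb : t ≤ b * √(φ b) := by
    apply le_of_sq_le_sq _ (by positivity)
    rw [hsq b hb0]
    have h2 : t ^ 2 ≤ b * φ b := hbe ▸ le_max_left _ _
    have h3 : 0 < b * φ b := mul_pos hb0 (hφ.pos b hb0)
    nlinarith
  have hsub : Icc a b ⊆ Ioi 0 := fun y hy => lt_of_lt_of_le ha0 hy.1
  have hcont : ContinuousOn (fun s => s * √(φ s)) (Icc a b) :=
    continuousOn_id.mul ((hφ.contDiffOn.continuousOn.mono hsub).sqrt)
  obtain ⟨s, hs, hse⟩ := intermediate_value_Icc (ha1.trans hb1) hcont ⟨hga, hgb⟩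
  exact ⟨s, hsub hs, hse⟩

/-- The defining relation of `Λ`. -/
theorem Lam_apply {φ : ℝ → ℝ} (hφ : Admissible φ) {s : ℝ} (hs : 0 < s) :
    Lam φ (s * √(φ s)) = -(s * deriv φ s / (s * deriv φ s + 2 * φ s)) := by
  have h : radius φ (s * √(φ s)) = s :=
    hφ.strictMonoOn.injOn.leftInvOn_invFunOn hs
  simp only [Lam, h]

/-- The limit `Λ_∞` exists. -/
theorem tendsto_Lam {φ : ℝ → ℝ} (hφ : Admissible φ) :
    Tendsto (Lam φ) atTop (𝓝 (LamInf φ)) := by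
  apply tendsto_nhds_limUnder
  have hX1 : ∀ s, 0 < s → -1 < s * deriv φ s / φ s := by
    intro s hs
    have h1 := hφ.deriv_pos s hs
    have hd : DifferentiableAt ℝ φ s :=
      (hφ.contDiffOn.differentiableOn one_ne_zero).differentiableAt (Ioi_mem_nhds hs)
    have h2 : deriv (fun t => t * φ t) s = φ s + s * deriv φ s := by
      have := ((hasDerivAt_id s).mul hd.hasDerivAt).deriv
      simpa [Pi.mul_def] using this
    rw [h2] at h1
    rw [lt_div_iff₀ (hφ.pos s hs)]
    linarith
  have hLX : ∀ s, 0 < s →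
      Lam φ (s * √(φ s)) = -((s * deriv φ s / φ s) / (s * deriv φ s / φ s + 2)) := by
    intro s hs
    have h0 := hφ.pos s hs
    rw [Lam_apply hφ hs]
    field_simp
  have hXc : ContinuousOn (fun s => s * deriv φ s / φ s) (Ioi 0) :=
    (continuousOn_id.mul (hφ.contDiffOn.continuousOn_deriv_of_isOpen isOpen_Ioi le_rfl)).div
      hφ.contDiffOn.continuousOn (fun s hs => (hφ.pos s hs).ne')
  have hXm := hφ.monotone_abs
  generalize hX : (fun s => s * deriv φ s / φ s) = X at hXc
  have hXs : ∀ s, s * deriv φ s / φ s = X s := fun s => by rw [← hX]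
  simp only [hXs] at hX1 hLX hXm
  have hinv : ∀ t, 0 < t → ∃ s, 0 < s ∧ s * √(φ s) = t := fun t ht => by
    obtain ⟨s, hs, he⟩ := hφ.surjOn ht
    exact ⟨s, hs, he⟩
  have hsign : ∀ s₀, 0 < s₀ → ∀ s, s₀ ≤ s → X s = 0 → X s₀ = 0 := by
    intro s₀ h0 s hs hz
    have := hXm h0 (lt_of_lt_of_le h0 hs : (0 : ℝ) < s) hs
    simp only [hz, abs_zero] at this
    exact abs_nonpos_iff.mp this
  have key : ∀ s₀, 0 < s₀ → (∀ s t, s₀ ≤ s → s ≤ t → X s ≤ X t) ∨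
      (∀ s t, s₀ ≤ s → s ≤ t → X t ≤ X s) →
      ∃ l, Tendsto (Lam φ) atTop (𝓝 l) := by
    intro s₀ h0 hmono
    have hg0 : 0 < s₀ * √(φ s₀) := mul_pos h0 (Real.sqrt_pos.mpr (hφ.pos s₀ h0))
    set t₀ := s₀ * √(φ s₀) with ht0
    have hev : (fun t => Lam φ (max t t₀)) =ᶠ[atTop] Lam φ := by
      filter_upwards [eventually_ge_atTop t₀] with t ht
      rw [max_eq_left ht]
    have hmul : ∀ t, t₀ ≤ t → ∃ s, s₀ ≤ s ∧ s * √(φ s) = t := by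
      intro t ht
      obtain ⟨s, hs, he⟩ := hinv t (hg0.trans_le ht)
      refine ⟨s, ?_, he⟩
      rw [← hφ.strictMonoOn.le_iff_le h0 hs]
      simp only [he]
      exact ht
    have hcmp : ∀ t t', t ≤ t' → ∃ s s', s₀ ≤ s ∧ s ≤ s' ∧
        Lam φ (max t t₀) = -(X s / (X s + 2)) ∧
        Lam φ (max t' t₀) = -(X s' / (X s' + 2)) := by
      intro t t' htt
      obtain ⟨s, hs, he⟩ := hmul (max t t₀) (le_max_right _ _)
      obtain ⟨s', hs', he'⟩ := hmul (max t' t₀) (le_max_right _ _)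
      have p : 0 < s := h0.trans_le hs
      have p' : 0 < s' := h0.trans_le hs'
      refine ⟨s, s', hs, ?_, ?_, ?_⟩
      · rw [← hφ.strictMonoOn.le_iff_le p p']
        simp only [he, he']
        exact max_le_max htt le_rfl
      · rw [← he, hLX s p]
      · rw [← he', hLX s' p']
    have hfrac : ∀ x y : ℝ, -1 < x → x ≤ y → x / (x + 2) ≤ y / (y + 2) := by
      intro x y hx hxy
      rw [div_le_div_iff₀ (by linarith) (by linarith)]
      nlinarith
    rcases hmono with hm | hm
    · refine ⟨_, (tendsto_atTop_ciInf (f := fun t => Lam φ (max t t₀)) ?_ ?_).congr' hev⟩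
      · intro t t' htt
        obtain ⟨s, s', h1, h2, h3, h4⟩ := hcmp t t' htt
        simp only [h3, h4]
        exact neg_le_neg (hfrac _ _ (hX1 s (h0.trans_le h1)) (hm s s' h1 h2))
      · refine ⟨-1, ?_⟩
        rintro _ ⟨t, rfl⟩
        obtain ⟨s, s', h1, h2, h3, h4⟩ := hcmp t t le_rfl
        simp only [h3]
        have := hX1 s (h0.trans_le h1)
        apply neg_le_neg
        rw [div_le_one (by linarith)]
        linarith
    · refine ⟨_, (tendsto_atTop_ciSup (f := fun t => Lam φ (max t t₀)) ?_ ?_).congr' hev⟩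
      · intro t t' htt
        obtain ⟨s, s', h1, h2, h3, h4⟩ := hcmp t t' htt
        simp only [h3, h4]
        exact neg_le_neg (hfrac _ _ (hX1 s' (h0.trans_le (h1.trans h2))) (hm s s' h1 h2))
      · refine ⟨1, ?_⟩
        rintro _ ⟨t, rfl⟩
        obtain ⟨s, s', h1, h2, h3, h4⟩ := hcmp t t le_rfl
        simp only [h3]
        have := hX1 s (h0.trans_le h1)
        rw [neg_le, le_div_iff₀ (by linarith)]
        linarith
  by_cases hall : ∀ s, 0 < s → X s = 0
  · apply key 1 one_pos
    left
    intro s t hs hst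
    rw [hall s (by linarith), hall t (by linarith)]
  · push Not at hall
    obtain ⟨s₀, h0, hne⟩ := hall
    have hsub : ∀ s, Icc s₀ s ⊆ Ioi 0 := fun s y hy => lt_of_lt_of_le h0 hy.1
    apply key s₀ h0
    rcases lt_or_gt_of_ne hne with hneg | hpos
    · right
      have hn : ∀ s, s₀ ≤ s → X s < 0 := by
        intro s hs
        by_contra hc
        obtain ⟨y, hy, hye⟩ := intermediate_value_Icc hs (hXc.mono (hsub s))
          (⟨hneg.le, not_lt.mp hc⟩ : (0 : ℝ) ∈ Icc (X s₀) (X s))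
        exact hne (hsign s₀ h0 y hy.1 hye)
      intro s t hs hst
      have := hXm (h0.trans_le hs : (0 : ℝ) < s) (h0.trans_le (hs.trans hst) : (0 : ℝ) < t) hst
      simp only [abs_of_neg (hn s hs), abs_of_neg (hn t (hs.trans hst))] at this
      linarith
    · left
      have hn : ∀ s, s₀ ≤ s → 0 < X s := by
        intro s hs
        by_contra hc
        obtain ⟨y, hy, hye⟩ := intermediate_value_Icc' hs (hXc.mono (hsub s))
          (⟨not_lt.mp hc, hpos.le⟩ : (0 : ℝ) ∈ Icc (X s) (X s₀))
        exact hne (hsign s₀ h0 y hy.1 hye)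
      intro s t hs hst
      have := hXm (h0.trans_le hs : (0 : ℝ) < s) (h0.trans_le (hs.trans hst) : (0 : ℝ) < t) hst
      simp only [abs_of_pos (hn s hs), abs_of_pos (hn t (hs.trans hst))] at this
      exact this

end FunctionalDissipativity

end

/-!
Write `Ψ(z) = φ(|z|) z`. Both implications go through the pointwise condition
`0 ≤ ⟪DΨ(z) ξ, 𝒜ʰ(x) ξ⟫` for all `z ≠ 0`, all `ξ` and almost every `x`.

It is sufficient because `∂ₕ(φ(|u|) u) = DΨ(u) ∂ₕu` where `u ≠ 0`, and because at a zero of `u` the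
energy density is the limit of the nonnegative quotients `φ(|u|) ⟪u, 𝒜ʰ u⟫ / t²`. It is necessary
because one can take `u` equal to the constant `z` on a compact set and add there the oscillation
`c⁻¹ η(x) cos(c² l(x) + θ) ξ`. After division by `c²` the energies for `θ = 0` and `θ = π/2` add up,
in the limit `c → ∞`, to the integral of `η² ∑ₕ l(eₕ)² ⟪DΨ(z) ξ, 𝒜ʰ ξ⟫`, and `η` localizes.

For fixed `|z| = s` the condition is a bound for the quadratic form
`|w|² ⟪ξ, 𝒜ξ⟫ + (sφ'(s)/φ(s)) ⟪w, ξ⟫ ⟪w, 𝒜ξ⟫`, whose extremal case lives in the plane spanned by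
eigenvectors for `μ₁` and `μₘ`. It amounts to `Λ² (μ₁ + μₘ)² ≤ 4 μ₁ μₘ` with the value of `Λ` that
belongs to `s`, and `Λ∞²` is the supremum of these values of `Λ²`, by monotonicity of
`|sφ'(s)/φ(s)|`.
-/

noncomputable section

namespace FunctionalDissipativity

section Weight

/-- The conditions on the weight `φ` that the characterization of dissipativity rests on: `φ` is a
positive `C¹` function on `(0, ∞)` and `s ↦ s φ(s)` is strictly increasing with limit `0` at `0`. -/
structure IsRadialWeight (φ : ℝ → ℝ) : Prop where
  pos : ∀ s, 0 < s → 0 < φ s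
  contDiffOn : ContDiffOn ℝ 1 φ (Ioi 0)
  deriv_pos : ∀ s, 0 < s → 0 < deriv (fun t => t * φ t) s
  tendsto_mul_self : Tendsto (fun s => s * φ s) (𝓝[>] 0) (𝓝 0)

/-- The logarithmic derivative `s φ'(s) / φ(s)` of `φ` with respect to `log s`. -/
def elasticity (φ : ℝ → ℝ) (s : ℝ) : ℝ := s * deriv φ s / φ s

/-- The function `Λ` in the variable `s`, that is `s ↦ Λ(s √(φ(s)))`. -/
def radialLam (φ : ℝ → ℝ) (s : ℝ) : ℝ := -(s * deriv φ s / (s * deriv φ s + 2 * φ s))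

variable {φ : ℝ → ℝ} {s t : ℝ}

theorem strictMonoOn_mul_self_of_deriv_pos (hcont : ContinuousOn φ (Ioi 0))
    (hderiv : ∀ s, 0 < s → 0 < deriv (fun t => t * φ t) s) :
    StrictMonoOn (fun t => t * φ t) (Ioi 0) := by
  refine strictMonoOn_of_deriv_pos (convex_Ioi 0) (continuousOn_id.mul hcont) fun s hs => ?_
  exact hderiv s (by rwa [interior_Ioi] at hs)

namespace IsRadialWeight

theorem contDiffAt (hφ : IsRadialWeight φ) (hs : 0 < s) : ContDiffAt ℝ 1 φ s :=
  hφ.contDiffOn.contDiffAt (Ioi_mem_nhds hs)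

theorem hasDerivAt (hφ : IsRadialWeight φ) (hs : 0 < s) : HasDerivAt φ (deriv φ s) s :=
  ((hφ.contDiffAt hs).differentiableAt one_ne_zero).hasDerivAt

theorem hasDerivAt_mul_self (hφ : IsRadialWeight φ) (hs : 0 < s) :
    HasDerivAt (fun t => t * φ t) (φ s + s * deriv φ s) s := by
  simpa only [id, one_mul] using (hasDerivAt_id s).fun_mul (hφ.hasDerivAt hs)

theorem neg_one_lt_elasticity (hφ : IsRadialWeight φ) (hs : 0 < s) : -1 < elasticity φ s := by
  have hderiv := hφ.deriv_pos s hs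
  rw [(hφ.hasDerivAt_mul_self hs).deriv] at hderiv
  rw [elasticity, lt_div_iff₀ (hφ.pos s hs)]
  linarith

theorem continuousOn_elasticity (hφ : IsRadialWeight φ) : ContinuousOn (elasticity φ) (Ioi 0) :=
  (continuousOn_id.mul (hφ.contDiffOn.continuousOn_deriv_of_isOpen isOpen_Ioi le_rfl)).div
    hφ.contDiffOn.continuousOn fun s hs => (hφ.pos s hs).ne'

theorem radialLam_eq (hφ : IsRadialWeight φ) (hs : 0 < s) :
    radialLam φ s = -(elasticity φ s / (elasticity φ s + 2)) := by
  have hpos := hφ.pos s hs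
  rw [radialLam, elasticity]
  field_simp

end IsRadialWeight

/-- On `(-2, ∞)` the map `x ↦ |x / (x + 2)|` increases with `|x|` on each side of `0`, but it is
larger on the negative side, so the two points must not have opposite signs. -/
theorem sq_div_add_two_le {x y : ℝ} (hx : -2 < x) (hy : -2 < y) (hxy : 0 ≤ x * y)
    (habs : |x| ≤ |y|) : (x / (x + 2)) ^ 2 ≤ (y / (y + 2)) ^ 2 := by
  have hx' : 0 < x + 2 := by linarith
  have hy' : 0 < y + 2 := by linarith
  rw [sq_le_sq, abs_div, abs_div, abs_of_pos hx', abs_of_pos hy', div_le_div_iff₀ hx' hy']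
  have hswap : |x| * y = |y| * x := by
    rcases mul_nonneg_iff.mp hxy with ⟨h₁, h₂⟩ | ⟨h₁, h₂⟩
    · rw [abs_of_nonneg h₁, abs_of_nonneg h₂, mul_comm]
    · rw [abs_of_nonpos h₁, abs_of_nonpos h₂]; ring
  linarith

namespace Admissible

theorem tendsto_mul_self (hφ : Admissible φ) : Tendsto (fun s => s * φ s) (𝓝[>] 0) (𝓝 0) := by
  have hmono := strictMonoOn_mul_self_of_deriv_pos hφ.contDiffOn.continuousOn hφ.deriv_pos
  have hlim := hmono.monotoneOn.tendsto_nhdsGT (by rw [hφ.range_eq]; exact bddBelow_Ioi)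
  rwa [hφ.range_eq, csInf_Ioi] at hlim

theorem isRadialWeight (hφ : Admissible φ) : IsRadialWeight φ :=
  ⟨hφ.pos, hφ.contDiffOn, hφ.deriv_pos, hφ.tendsto_mul_self⟩

theorem elasticity_mul_elasticity_nonneg (hφ : Admissible φ) (hs : 0 < s) (hst : s ≤ t) :
    0 ≤ elasticity φ s * elasticity φ t := by
  by_contra! hneg
  have hcont : ContinuousOn (elasticity φ) (uIcc s t) :=
    hφ.isRadialWeight.continuousOn_elasticity.mono fun y hy =>
      hs.trans_le (uIcc_of_le hst ▸ hy).1
  obtain ⟨y, hy, hy0⟩ : (0 : ℝ) ∈ elasticity φ '' uIcc s t := by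
    refine intermediate_value_uIcc hcont (mem_uIcc.mpr ?_)
    rcases mul_neg_iff.mp hneg with ⟨h₁, h₂⟩ | ⟨h₁, h₂⟩
    · exact Or.inr ⟨h₂.le, h₁.le⟩
    · exact Or.inl ⟨h₁.le, h₂.le⟩
  have hsy : s ≤ y := (uIcc_of_le hst ▸ hy).1
  have habs : |elasticity φ s| ≤ |elasticity φ y| :=
    hφ.monotone_abs hs (hs.trans_le hsy) hsy
  rw [hy0, abs_zero, abs_nonpos_iff] at habs
  rw [habs, zero_mul] at hneg
  exact hneg.false

theorem monotoneOn_radialLam_sq (hφ : Admissible φ) :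
    MonotoneOn (fun s => radialLam φ s ^ 2) (Ioi 0) := by
  intro s hs t ht hst
  have hw := hφ.isRadialWeight
  have hXs := hw.neg_one_lt_elasticity hs
  have hXt := hw.neg_one_lt_elasticity ht
  simp only [hw.radialLam_eq hs, hw.radialLam_eq ht, neg_sq]
  exact sq_div_add_two_le (by linarith) (by linarith)
    (hφ.elasticity_mul_elasticity_nonneg hs hst) (hφ.monotone_abs hs ht hst)

theorem tendsto_mul_sqrt_atTop (hφ : Admissible φ) :
    Tendsto (fun s => s * √(φ s)) atTop atTop := by
  refine tendsto_atTop.mpr fun b => ?_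
  obtain ⟨s₀, hs₀, hb⟩ := hφ.surjOn (lt_max_of_lt_right one_pos : 0 < max b 1)
  filter_upwards [eventually_ge_atTop s₀] with s hs
  exact ((le_max_left b 1).trans_eq hb.symm).trans
    (hφ.strictMonoOn.monotoneOn hs₀ (lt_of_lt_of_le hs₀ hs) hs)

theorem tendsto_radialLam (hφ : Admissible φ) :
    Tendsto (radialLam φ) atTop (𝓝 (LamInf φ)) := by
  refine ((tendsto_Lam hφ).comp hφ.tendsto_mul_sqrt_atTop).congr' ?_
  filter_upwards [eventually_gt_atTop 0] with s hs using Lam_apply hφ hs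

theorem isLUB_radialLam_sq (hφ : Admissible φ) :
    IsLUB ((fun s => radialLam φ s ^ 2) '' Ioi 0) (LamInf φ ^ 2) := by
  have hlim := hφ.tendsto_radialLam.pow 2
  refine ⟨?_, fun b hb => le_of_tendsto hlim ?_⟩
  · rintro _ ⟨s, hs, rfl⟩
    refine ge_of_tendsto hlim ?_
    filter_upwards [eventually_ge_atTop s] with t ht
    exact hφ.monotoneOn_radialLam_sq hs (lt_of_lt_of_le hs ht) ht
  · filter_upwards [eventually_gt_atTop 0] with s hs using hb (mem_image_of_mem _ hs)

end Admissible

end Weight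

section RadialMap

variable {E : Type*} [NormedAddCommGroup E] [InnerProductSpace ℝ E] {φ : ℝ → ℝ} {z : E}

/-- The radial map `z ↦ φ(|z|) z`, so that `φ(|u|) u` is `radialMap φ ∘ u`. -/
def radialMap (φ : ℝ → ℝ) (z : E) : E := φ ‖z‖ • z

theorem IsRadialWeight.contDiffAt_radialMap (hφ : IsRadialWeight φ) (hz : z ≠ 0) :
    ContDiffAt ℝ 1 (radialMap φ) z :=
  ((hφ.contDiffAt (norm_pos_iff.mpr hz)).comp z (contDiffAt_norm ℝ hz)).smul contDiffAt_id

theorem hasFDerivAt_norm_of_ne_zero (hz : z ≠ 0) :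
    HasFDerivAt (fun y : E => ‖y‖) (‖z‖⁻¹ • innerSL ℝ z) z := by
  have h := (hasStrictFDerivAt_norm_sq z).hasFDerivAt.sqrt (by simpa using hz)
  simp only [Real.sqrt_sq (norm_nonneg _)] at h
  convert h using 1
  ext y
  simp only [one_div, mul_inv_rev, smul_apply, coe_innerSL_apply, nsmul_eq_mul, Nat.cast_ofNat,
    smul_eq_mul]
  field_simp

theorem hasFDerivAt_radialMap {φ' : ℝ} (hφ : HasDerivAt φ φ' ‖z‖) (hz : z ≠ 0) :
    HasFDerivAt (radialMap φ)
      (φ ‖z‖ • ContinuousLinearMap.id ℝ E + (φ' • ‖z‖⁻¹ • innerSL ℝ z).smulRight z) z :=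
  (hφ.comp_hasFDerivAt z (hasFDerivAt_norm_of_ne_zero hz)).smul (hasFDerivAt_id z)

theorem IsRadialWeight.inner_fderiv_radialMap (hφ : IsRadialWeight φ) (hz : z ≠ 0) (ζ y : E) :
    inner ℝ (fderiv ℝ (radialMap φ) z ζ) y =
      φ ‖z‖ / ‖z‖ ^ 2 *
        (‖z‖ ^ 2 * inner ℝ ζ y + elasticity φ ‖z‖ * (inner ℝ z ζ * inner ℝ z y)) := by
  have hnorm := norm_pos_iff.mpr hz
  have hpos := hφ.pos _ hnorm
  rw [(hasFDerivAt_radialMap (hφ.hasDerivAt hnorm) hz).fderiv]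
  simp only [add_apply, smul_apply, ContinuousLinearMap.id_apply,
    ContinuousLinearMap.smulRight_apply, innerSL_apply_apply, smul_eq_mul, inner_add_left,
    real_inner_smul_left, elasticity]
  field_simp

/-- By homogeneity in `z`, the vectors of any fixed norm already give the whole quadratic form. -/
theorem IsRadialWeight.forall_norm_eq_inner_fderiv_nonneg_iff (hφ : IsRadialWeight φ) {s : ℝ}
    (hs : 0 < s) (T : E → E) :
    (∀ z : E, ‖z‖ = s → ∀ ξ, 0 ≤ (inner ℝ (fderiv ℝ (radialMap φ) z ξ) (T ξ) : ℝ)) ↔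
      ∀ w ξ : E, 0 ≤ ‖w‖ ^ 2 * inner ℝ ξ (T ξ) +
        elasticity φ s * (inner ℝ w ξ * inner ℝ w (T ξ)) := by
  have hφs := hφ.pos s hs
  constructor
  · intro h w ξ
    rcases eq_or_ne w 0 with rfl | hw
    · simp
    have hw' := norm_pos_iff.mpr hw
    have hnorm : ‖(s / ‖w‖) • w‖ = s := by
      rw [norm_smul, Real.norm_of_nonneg (by positivity), div_mul_cancel₀ _ hw'.ne']
    have hq := h _ hnorm ξ
    rw [hφ.inner_fderiv_radialMap (norm_pos_iff.mp (by rwa [hnorm])), hnorm, real_inner_smul_left,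
      real_inner_smul_left] at hq
    refine nonneg_of_mul_nonneg_right ((nonneg_of_mul_nonneg_right hq (by positivity)).trans_eq ?_)
      (by positivity : 0 < (s / ‖w‖) ^ 2)
    field_simp
  · rintro h z rfl ξ
    rw [hφ.inner_fderiv_radialMap (norm_pos_iff.mp hs)]
    exact mul_nonneg (by positivity) (h z ξ)

/-- The coefficient `S` is nonnegative against the derivative of the radial map: this is the
pointwise form of `L^Φ`-dissipativity. -/
def IsRadiallyAccretive (φ : ℝ → ℝ) (S : E → E) : Prop :=
  ∀ z : E, z ≠ 0 → ∀ ξ, 0 ≤ (inner ℝ (fderiv ℝ (radialMap φ) z ξ) (S ξ) : ℝ)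

end RadialMap

section QuadraticForm

variable {E : Type*} [NormedAddCommGroup E] [InnerProductSpace ℝ E] {a b g X : ℝ} {ξ y : E}

/-- Replacing `g` by `-g` gives the lower bound for the product of the two inner products. -/
theorem four_mul_inner_mul_inner_le (hg : g ^ 2 = a * b)
    (hy : ‖y‖ ^ 2 ≤ (a + b) * inner ℝ ξ y - a * b * ‖ξ‖ ^ 2) (w : E) :
    4 * g * (inner ℝ w ξ * inner ℝ w y) ≤ ‖w‖ ^ 2 * ((a + b + 2 * g) * inner ℝ ξ y) := by
  have hnorm : ‖g • ξ + y‖ ^ 2 = a * b * ‖ξ‖ ^ 2 + 2 * g * inner ℝ ξ y + ‖y‖ ^ 2 := by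
    rw [norm_add_sq_real, real_inner_smul_left, norm_smul, mul_pow, Real.norm_eq_abs, sq_abs, hg]
    ring
  calc 4 * g * (inner ℝ w ξ * inner ℝ w y)
      ≤ (g * inner ℝ w ξ + inner ℝ w y) ^ 2 := by
        linarith [sq_nonneg (g * inner ℝ w ξ - inner ℝ w y)]
    _ = |inner ℝ w (g • ξ + y)| ^ 2 := by rw [inner_add_right, real_inner_smul_right, sq_abs]
    _ ≤ (‖w‖ * ‖g • ξ + y‖) ^ 2 := by gcongr; exact abs_real_inner_le_norm _ _
    _ = ‖w‖ ^ 2 * ‖g • ξ + y‖ ^ 2 := mul_pow _ _ 2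
    _ ≤ ‖w‖ ^ 2 * ((a + b + 2 * g) * inner ℝ ξ y) := by gcongr; linarith

theorem inner_nonneg_of_norm_sq_le (hab : 0 < a + b) (hab' : 0 ≤ a * b)
    (hy : ‖y‖ ^ 2 ≤ (a + b) * inner ℝ ξ y - a * b * ‖ξ‖ ^ 2) : 0 ≤ (inner ℝ ξ y : ℝ) := by
  refine nonneg_of_mul_nonneg_right ?_ hab
  linarith [sq_nonneg ‖y‖, mul_nonneg hab' (sq_nonneg ‖ξ‖)]

theorem sq_div_add_two_mul_sq_le_iff (hX : 0 < X + 2) (hab : 0 ≤ a + b) (hg : 0 ≤ g)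
    (hgab : g ^ 2 = a * b) :
    (X / (X + 2)) ^ 2 * (a + b) ^ 2 ≤ 4 * a * b ↔ |X| * (a + b) ≤ 2 * g * (X + 2) := by
  have hsq : 4 * a * b = (2 * g) ^ 2 := by rw [mul_pow, hgab]; ring
  rw [hsq, ← mul_pow, sq_le_sq, abs_mul, abs_div, abs_of_pos hX, abs_of_nonneg hab,
    abs_of_nonneg (by positivity : 0 ≤ 2 * g), div_mul_eq_mul_div, div_le_iff₀ hX]

theorem quadraticForm_nonneg (ha : 0 < a) (hb : 0 < b)
    (hX : |X| * (a + b) ≤ 2 * √(a * b) * (X + 2))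
    (hy : ‖y‖ ^ 2 ≤ (a + b) * inner ℝ ξ y - a * b * ‖ξ‖ ^ 2) (w : E) :
    0 ≤ ‖w‖ ^ 2 * inner ℝ ξ y + X * (inner ℝ w ξ * inner ℝ w y) := by
  have hg : 0 < √(a * b) := by positivity
  have hgab : √(a * b) ^ 2 = a * b := Real.sq_sqrt (by positivity)
  have hξy : 0 ≤ ‖w‖ ^ 2 * inner ℝ ξ y :=
    mul_nonneg (sq_nonneg _) (inner_nonneg_of_norm_sq_le (by positivity) (by positivity) hy)
  refine nonneg_of_mul_nonneg_right ?_ (by positivity : 0 < 4 * √(a * b))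
  rcases le_total 0 X with hX0 | hX0
  · rw [abs_of_nonneg hX0] at hX
    have h := four_mul_inner_mul_inner_le (g := -√(a * b)) (by rwa [neg_sq]) hy w
    linarith [mul_le_mul_of_nonneg_left h hX0, mul_le_mul_of_nonneg_right hX hξy]
  · rw [abs_of_nonpos hX0] at hX
    have h := four_mul_inner_mul_inner_le hgab hy w
    linarith [mul_le_mul_of_nonpos_left h hX0, mul_le_mul_of_nonneg_right hX hξy]

/-- The extremal vectors in `quadraticForm_nonneg` are `ξ = √b e + √a f` and `w = ± e + f`. -/
theorem abs_mul_add_le_of_quadraticForm_nonneg (ha : 0 < a) (hb : 0 < b) {T : E →ₗ[ℝ] E} {e f : E}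
    (he : ‖e‖ = 1) (hf : ‖f‖ = 1) (hef : inner ℝ e f = 0) (hTe : T e = a • e) (hTf : T f = b • f)
    (hT : ∀ w ξ : E, 0 ≤ ‖w‖ ^ 2 * inner ℝ ξ (T ξ) + X * (inner ℝ w ξ * inner ℝ w (T ξ))) :
    |X| * (a + b) ≤ 2 * √(a * b) * (X + 2) := by
  have hP := Real.sqrt_pos.mpr ha
  have hQ := Real.sqrt_pos.mpr hb
  have hPa := Real.sq_sqrt ha.le
  have hQb := Real.sq_sqrt hb.le
  rw [Real.sqrt_mul ha.le]
  generalize √a = P at hP hPa ⊢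
  generalize √b = Q at hQ hQb ⊢
  subst hPa hQb
  have hfe : inner ℝ f e = 0 := by rw [real_inner_comm, hef]
  have hee : inner ℝ e e = (1 : ℝ) := by rw [real_inner_self_eq_norm_sq, he, one_pow]
  have hff : inner ℝ f f = (1 : ℝ) := by rw [real_inner_self_eq_norm_sq, hf, one_pow]
  have hextremal : ∀ σ : ℝ, σ ^ 2 = 1 → 0 ≤ 4 * (P * Q) + σ * X * (P + σ * Q) ^ 2 := by
    intro σ hσ
    have h := hT (σ • e + f) (Q • e + P • f)
    rw [← real_inner_self_eq_norm_sq] at h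
    simp only [map_add, map_smul, hTe, hTf, inner_add_left, inner_add_right, real_inner_smul_left,
      real_inner_smul_right, hee, hff, hef, hfe] at h
    refine nonneg_of_mul_nonneg_right (h.trans_eq ?_) (mul_pos hP hQ)
    linear_combination (2 * P ^ 2 * Q ^ 2 - X * (P * Q) * (P * Q + σ * Q ^ 2)) * hσ
  have hplus := hextremal 1 (one_pow 2)
  have hminus := hextremal (-1) (by norm_num)
  rcases abs_cases X with ⟨h, -⟩ | ⟨h, -⟩ <;> rw [h] <;> linarith

end QuadraticForm

section Spectral

theorem norm_map_sq_le_of_orthonormalBasis_eigenvectors {𝕜 E ι : Type*} [RCLike 𝕜] [Fintype ι]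
    [NormedAddCommGroup E] [InnerProductSpace 𝕜 E] (B : OrthonormalBasis ι 𝕜 E) {T : E →ₗ[𝕜] E}
    {μ : ι → ℝ} (hT : ∀ i, T (B i) = (μ i : 𝕜) • B i) {a b : ℝ} (hμ : ∀ i, μ i ∈ Icc a b) (x : E) :
    ‖T x‖ ^ 2 ≤ (a + b) * RCLike.re (inner 𝕜 x (T x)) - a * b * ‖x‖ ^ 2 := by
  classical
  have hcoord : ∀ i, inner 𝕜 (B i) (T x) = (μ i : 𝕜) * inner 𝕜 (B i) x := by
    intro i
    conv_lhs => rw [← B.sum_repr x]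
    simp only [map_sum, map_smul, hT, B.repr_apply_apply, inner_sum, inner_smul_right,
      B.inner_eq_ite, mul_ite, mul_one, mul_zero, Finset.sum_ite_eq, Finset.mem_univ, if_true]
    ring
  have hinner : RCLike.re (inner 𝕜 x (T x)) = ∑ i, μ i * ‖inner 𝕜 (B i) x‖ ^ 2 := by
    rw [← B.sum_inner_mul_inner x (T x), map_sum]
    refine Finset.sum_congr rfl fun i _ => ?_
    rw [hcoord, mul_left_comm, ← inner_conj_symm x, RCLike.conj_mul]
    norm_cast
  rw [← B.sum_sq_norm_inner_right (T x), ← B.sum_sq_norm_inner_right x, hinner, Finset.mul_sum,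
    Finset.mul_sum, ← Finset.sum_sub_distrib]
  refine Finset.sum_le_sum fun i _ => ?_
  rw [hcoord, norm_mul, mul_pow, RCLike.norm_ofReal, sq_abs]
  nlinarith [mul_nonneg (mul_nonneg (sub_nonneg.mpr (hμ i).1) (sub_nonneg.mpr (hμ i).2))
    (sq_nonneg ‖inner 𝕜 (B i) x‖)]

variable {m : ℕ} {M : Matrix (Fin m) (Fin m) ℝ}

theorem setOf_hasEigenvalue_eq_spectrum (M : Matrix (Fin m) (Fin m) ℝ) :
    {μ : ℝ | Module.End.HasEigenvalue (Matrix.toLin' M) μ} = spectrum ℝ M := by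
  ext μ
  rw [mem_ofPred_eq, Module.End.hasEigenvalue_iff_mem_spectrum, Matrix.spectrum_toLin']

theorem isHermitian_map_ofReal (hM : M.IsSymm) : (M.map Complex.ofReal).IsHermitian := by
  ext i j
  simp [hM.apply]

theorem spectrum_map_ofReal (M : Matrix (Fin m) (Fin m) ℝ) :
    spectrum ℝ (M.map Complex.ofReal) = spectrum ℝ M := by
  ext μ
  have hmap : algebraMap ℝ (Matrix (Fin m) (Fin m) ℂ) μ - M.map Complex.ofReal =
      Complex.ofRealHom.mapMatrix (algebraMap ℝ _ μ - M) := by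
    rw [map_sub]
    congr 1
    ext i j
    simp [Matrix.algebraMap_matrix_apply, apply_ite Complex.ofReal]
  rw [spectrum.mem_iff, spectrum.mem_iff, hmap, Matrix.isUnit_iff_isUnit_det,
    Matrix.isUnit_iff_isUnit_det, ← RingHom.map_det, isUnit_iff_ne_zero, isUnit_iff_ne_zero,
    map_ne_zero]

theorem range_eigenvalues_map_ofReal (hM : (M.map Complex.ofReal).IsHermitian) :
    range hM.eigenvalues = {μ : ℝ | Module.End.HasEigenvalue (Matrix.toLin' M) μ} := by
  rw [setOf_hasEigenvalue_eq_spectrum, ← spectrum_map_ofReal,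
    hM.spectrum_real_eq_range_eigenvalues]

theorem eigenvalues_map_ofReal_mem_Icc (hM : (M.map Complex.ofReal).IsHermitian) (i : Fin m) :
    hM.eigenvalues i ∈ Icc (minEigenvalue M) (maxEigenvalue M) := by
  rw [minEigenvalue, maxEigenvalue, ← range_eigenvalues_map_ofReal hM]
  exact ⟨csInf_le (finite_range _).bddBelow (mem_range_self i),
    le_csSup (finite_range _).bddAbove (mem_range_self i)⟩

theorem exists_eigenvalues_map_ofReal_eq_minEigenvalue [NeZero m]
    (hM : (M.map Complex.ofReal).IsHermitian) : ∃ i, hM.eigenvalues i = minEigenvalue M := by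
  rw [minEigenvalue, ← range_eigenvalues_map_ofReal hM]
  exact (range_nonempty _).csInf_mem (finite_range _)

theorem exists_eigenvalues_map_ofReal_eq_maxEigenvalue [NeZero m]
    (hM : (M.map Complex.ofReal).IsHermitian) : ∃ i, hM.eigenvalues i = maxEigenvalue M := by
  rw [maxEigenvalue, ← range_eigenvalues_map_ofReal hM]
  exact (range_nonempty _).csSup_mem (finite_range _)

theorem hasEigenvalue_minEigenvalue [NeZero m] (hM : M.IsSymm) :
    Module.End.HasEigenvalue (Matrix.toLin' M) (minEigenvalue M) := by
  have hN := isHermitian_map_ofReal hM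
  obtain ⟨i, hi⟩ := exists_eigenvalues_map_ofReal_eq_minEigenvalue hN
  exact (range_eigenvalues_map_ofReal hN).subset ⟨i, hi⟩

theorem minEigenvalue_pos [NeZero m] (hM : M.IsSymm)
    (hpos : ∀ ξ : Fin m → ℝ, ξ ≠ 0 → 0 < dotProduct (M.mulVec ξ) ξ) : 0 < minEigenvalue M := by
  obtain ⟨ξ, hξ⟩ := (hasEigenvalue_minEigenvalue hM).exists_hasEigenvector
  have hMξ := hpos ξ hξ.2
  rw [← Matrix.toLin'_apply, hξ.apply_eq_smul, smul_dotProduct, smul_eq_mul] at hMξ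
  exact pos_of_mul_pos_left hMξ (dotProduct_self_star_nonneg ξ)

theorem minEigenvalue_le_maxEigenvalue [NeZero m] (hM : M.IsSymm) :
    minEigenvalue M ≤ maxEigenvalue M :=
  nonempty_Icc.mp ⟨_, eigenvalues_map_ofReal_mem_Icc (isHermitian_map_ofReal hM) 0⟩

theorem spectrum_fin_two {M : Matrix (Fin 2) (Fin 2) ℝ} (hM : M.IsHermitian) :
    {μ : ℝ | Module.End.HasEigenvalue (Matrix.toLin' M) μ} =
      {hM.eigenvalues 0, hM.eigenvalues 1} := by
  rw [setOf_hasEigenvalue_eq_spectrum, hM.spectrum_real_eq_range_eigenvalues]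
  ext μ
  simp [Fin.exists_fin_two, eq_comm]

theorem trace_eq_minEigenvalue_add_maxEigenvalue {M : Matrix (Fin 2) (Fin 2) ℝ} (hM : M.IsSymm) :
    M.trace = minEigenvalue M + maxEigenvalue M := by
  have hH : M.IsHermitian := by simpa using hM
  rw [minEigenvalue, maxEigenvalue, spectrum_fin_two hH, csInf_pair, csSup_pair,
    hH.trace_eq_sum_eigenvalues, Fin.sum_univ_two]
  exact (min_add_max _ _).symm

theorem det_eq_minEigenvalue_mul_maxEigenvalue {M : Matrix (Fin 2) (Fin 2) ℝ} (hM : M.IsSymm) :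
    M.det = minEigenvalue M * maxEigenvalue M := by
  have hH : M.IsHermitian := by simpa using hM
  rw [minEigenvalue, maxEigenvalue, spectrum_fin_two hH, csInf_pair, csSup_pair,
    hH.det_eq_prod_eigenvalues, Fin.prod_univ_two]
  exact (min_mul_max _ _).symm

end Spectral

section ComplexAction

variable {m : ℕ} {M : Matrix (Fin m) (Fin m) ℝ}

/-- The action of a real matrix on `ℂ^m`, as a map between real inner product spaces. -/
def complexAction (M : Matrix (Fin m) (Fin m) ℝ) :
    EuclideanSpace ℂ (Fin m) →L[ℝ] EuclideanSpace ℂ (Fin m) :=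
  (Matrix.toEuclideanCLM (𝕜 := ℂ) (M.map Complex.ofReal)).restrictScalars ℝ

theorem complexAction_apply (M : Matrix (Fin m) (Fin m) ℝ) (z : EuclideanSpace ℂ (Fin m)) :
    complexAction M z = WithLp.toLp 2 ((M.map Complex.ofReal).mulVec (WithLp.ofLp z)) := rfl

theorem re_inner_complex_eq_inner_real (z w : EuclideanSpace ℂ (Fin m)) :
    (inner ℂ z w).re = inner ℝ z w := by
  simp only [PiLp.inner_apply, Complex.re_sum]
  rfl

theorem complexAction_eigenvectorBasis (hM : (M.map Complex.ofReal).IsHermitian) (i : Fin m) :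
    complexAction M (hM.eigenvectorBasis i) = hM.eigenvalues i • hM.eigenvectorBasis i := by
  rw [complexAction_apply, hM.mulVec_eigenvectorBasis]
  rfl

theorem norm_complexAction_sq_le (hM : M.IsSymm) (z : EuclideanSpace ℂ (Fin m)) :
    ‖complexAction M z‖ ^ 2 ≤
      (minEigenvalue M + maxEigenvalue M) * inner ℝ z (complexAction M z) -
        minEigenvalue M * maxEigenvalue M * ‖z‖ ^ 2 := by
  have hN := isHermitian_map_ofReal hM
  rw [← re_inner_complex_eq_inner_real]
  exact norm_map_sq_le_of_orthonormalBasis_eigenvectors hN.eigenvectorBasis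
    (T := (Matrix.toEuclideanCLM (𝕜 := ℂ) (M.map Complex.ofReal)).toLinearMap)
    (complexAction_eigenvectorBasis hN) (eigenvalues_map_ofReal_mem_Icc hN) z

theorem exists_unit_eigenvectors_min_max [NeZero m] (hM : M.IsSymm)
    (hne : minEigenvalue M ≠ maxEigenvalue M) :
    ∃ e f : EuclideanSpace ℂ (Fin m), ‖e‖ = 1 ∧ ‖f‖ = 1 ∧ inner ℝ e f = (0 : ℝ) ∧
      complexAction M e = minEigenvalue M • e ∧ complexAction M f = maxEigenvalue M • f := by
  have hN := isHermitian_map_ofReal hM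
  obtain ⟨i, hi⟩ := exists_eigenvalues_map_ofReal_eq_minEigenvalue hN
  obtain ⟨j, hj⟩ := exists_eigenvalues_map_ofReal_eq_maxEigenvalue hN
  have hij : i ≠ j := by
    rintro rfl
    exact hne (hi.symm.trans hj)
  have hB := hN.eigenvectorBasis.orthonormal
  refine ⟨hN.eigenvectorBasis i, hN.eigenvectorBasis j, hB.1 i, hB.1 j, ?_,
    hi ▸ complexAction_eigenvectorBasis hN i, hj ▸ complexAction_eigenvectorBasis hN j⟩
  rw [← re_inner_complex_eq_inner_real, hB.2 hij, Complex.zero_re]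

end ComplexAction

section PointwiseCondition

variable {m : ℕ} [NeZero m] {φ : ℝ → ℝ} {M : Matrix (Fin m) (Fin m) ℝ}

theorem radialLam_sq_mul_le_iff (hφ : IsRadialWeight φ) {s a b : ℝ} (hs : 0 < s) (ha : 0 < a)
    (hb : 0 < b) :
    radialLam φ s ^ 2 * (a + b) ^ 2 ≤ 4 * a * b ↔
      |elasticity φ s| * (a + b) ≤ 2 * √(a * b) * (elasticity φ s + 2) := by
  have hX := hφ.neg_one_lt_elasticity hs
  rw [hφ.radialLam_eq hs, neg_sq, sq_div_add_two_mul_sq_le_iff (by linarith) (by positivity)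
    (Real.sqrt_nonneg _) (Real.sq_sqrt (by positivity))]

theorem forall_quadraticForm_complexAction_nonneg_iff {X : ℝ} (hX : -1 < X) (hM : M.IsSymm)
    (hpos : ∀ ξ : Fin m → ℝ, ξ ≠ 0 → 0 < dotProduct (M.mulVec ξ) ξ) :
    (∀ w ξ : EuclideanSpace ℂ (Fin m), 0 ≤ ‖w‖ ^ 2 * inner ℝ ξ (complexAction M ξ) +
      X * (inner ℝ w ξ * inner ℝ w (complexAction M ξ))) ↔
    |X| * (minEigenvalue M + maxEigenvalue M) ≤
      2 * √(minEigenvalue M * maxEigenvalue M) * (X + 2) := by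
  have ha := minEigenvalue_pos hM hpos
  have hb := ha.trans_le (minEigenvalue_le_maxEigenvalue hM)
  refine ⟨fun h => ?_, fun h w ξ => quadraticForm_nonneg ha hb h (norm_complexAction_sq_le hM ξ) w⟩
  rcases eq_or_ne (minEigenvalue M) (maxEigenvalue M) with heq | hne
  · have habs : |X| ≤ X + 2 := abs_le.mpr ⟨by linarith, by linarith⟩
    rw [← heq, Real.sqrt_mul_self ha.le]
    linarith [mul_le_mul_of_nonneg_left habs ha.le]
  · obtain ⟨e, f, he, hf, hef, hTe, hTf⟩ := exists_unit_eigenvectors_min_max hM hne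
    exact abs_mul_add_le_of_quadraticForm_nonneg ha hb he hf hef
      (T := (complexAction M).toLinearMap) hTe hTf h

theorem forall_norm_eq_inner_fderiv_radialMap_nonneg_iff (hφ : IsRadialWeight φ) (hM : M.IsSymm)
    (hpos : ∀ ξ : Fin m → ℝ, ξ ≠ 0 → 0 < dotProduct (M.mulVec ξ) ξ) {s : ℝ} (hs : 0 < s) :
    (∀ z : EuclideanSpace ℂ (Fin m), ‖z‖ = s → ∀ ξ,
      0 ≤ (inner ℝ (fderiv ℝ (radialMap φ) z ξ) (complexAction M ξ) : ℝ)) ↔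
    radialLam φ s ^ 2 * (minEigenvalue M + maxEigenvalue M) ^ 2 ≤
      4 * minEigenvalue M * maxEigenvalue M := by
  have ha := minEigenvalue_pos hM hpos
  have hb := ha.trans_le (minEigenvalue_le_maxEigenvalue hM)
  rw [hφ.forall_norm_eq_inner_fderiv_nonneg_iff hs, radialLam_sq_mul_le_iff hφ hs ha hb,
    forall_quadraticForm_complexAction_nonneg_iff (hφ.neg_one_lt_elasticity hs) hM hpos]

theorem isRadiallyAccretive_complexAction_iff (hφ : IsRadialWeight φ) {κ : ℝ}
    (hκ : IsLUB ((fun s => radialLam φ s ^ 2) '' Ioi 0) κ) (hM : M.IsSymm)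
    (hpos : ∀ ξ : Fin m → ℝ, ξ ≠ 0 → 0 < dotProduct (M.mulVec ξ) ξ) :
    IsRadiallyAccretive φ (complexAction M) ↔
      κ * (minEigenvalue M + maxEigenvalue M) ^ 2 ≤ 4 * minEigenvalue M * maxEigenvalue M := by
  have ha := minEigenvalue_pos hM hpos
  have hb := ha.trans_le (minEigenvalue_le_maxEigenvalue hM)
  have hsq : 0 < (minEigenvalue M + maxEigenvalue M) ^ 2 := by positivity
  rw [← le_div_iff₀ hsq, isLUB_le_iff hκ, mem_upperBounds, forall_mem_image]
  refine ⟨fun h s hs => ?_, fun h z hz => ?_⟩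
  · rw [le_div_iff₀ hsq, ← forall_norm_eq_inner_fderiv_radialMap_nonneg_iff hφ hM hpos hs]
    rintro z rfl
    exact h z (norm_pos_iff.mp hs)
  · have hs := norm_pos_iff.mpr hz
    exact (forall_norm_eq_inner_fderiv_radialMap_nonneg_iff hφ hM hpos hs).mpr
      ((le_div_iff₀ hsq).mp (h hs)) z rfl

end PointwiseCondition

section EnergyDensity

theorem integrableOn_inner_clm_apply {X 𝕜 F : Type*} [TopologicalSpace X] [MeasurableSpace X]
    [OpensMeasurableSpace X] [T2Space X] [RCLike 𝕜] [NormedAddCommGroup F] [InnerProductSpace 𝕜 F]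
    [NormedSpace ℝ F] [SecondCountableTopology F] {μ : Measure X} {T : X → F →L[ℝ] F}
    {p q : X → F} {K : Set X}
    (hK : IsCompact K) (hT : IntegrableOn T K μ) (hp : ContinuousOn p K) (hq : ContinuousOn q K) :
    IntegrableOn (fun x => inner 𝕜 (p x) (T x (q x))) K μ := by
  obtain ⟨P, hP⟩ := hK.exists_bound_of_continuousOn hp
  obtain ⟨Q, hQ⟩ := hK.exists_bound_of_continuousOn hq
  have hp' := hp.aestronglyMeasurable (μ := μ) hK.measurableSet
  have hq' := hq.aestronglyMeasurable (μ := μ) hK.measurableSet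
  refine (hT.norm.const_mul (P * Q)).mono' (hp'.inner ?_) ?_
  · exact isBoundedBilinearMap_apply.continuous.comp_aestronglyMeasurable
      (hT.aestronglyMeasurable.prodMk hq')
  · filter_upwards [ae_restrict_mem hK.measurableSet] with x hx
    calc ‖inner 𝕜 (p x) (T x (q x))‖ ≤ ‖p x‖ * (‖T x‖ * ‖q x‖) :=
          (norm_inner_le_norm _ _).trans (by gcongr; exact (T x).le_opNorm _)
      _ ≤ P * (‖T x‖ * Q) := by
          gcongr
          exacts [(norm_nonneg _).trans (hP x hx), hP x hx, hQ x hx]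
      _ = P * Q * ‖T x‖ := by ring

variable {n m : ℕ}

theorem integrable_linearMap_matrix {X ι κ G : Type*} [MeasurableSpace X] {μ : Measure X}
    [Finite ι] [Finite κ] [NormedAddCommGroup G] [NormedSpace ℝ G]
    {A : X → Matrix ι κ ℝ} (hA : ∀ i j, Integrable (fun x => A x i j) μ)
    (L : Matrix ι κ ℝ →ₗ[ℝ] G) : Integrable (fun x => L (A x)) μ := by
  classical
  have := Fintype.ofFinite ι
  have := Fintype.ofFinite κ
  have hL (x : X) : L (A x) = ∑ i, ∑ j, A x i j • L (Matrix.single i j 1) := by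
    conv_lhs => rw [Matrix.matrix_eq_sum_single (A x)]
    simp only [map_sum, ← map_smul, Matrix.smul_single, smul_eq_mul, mul_one]
  simp only [hL]
  exact integrable_finsetSum _ fun i _ => integrable_finsetSum _ fun j _ => (hA i j).smul_const _

theorem integrable_complexAction {X : Type*} [MeasurableSpace X] {μ : Measure X}
    {A : X → Matrix (Fin m) (Fin m) ℝ} (hA : ∀ i j, Integrable (fun x => A x i j) μ) :
    Integrable (fun x => complexAction (A x)) μ :=
  integrable_linearMap_matrix hA
    { toFun := complexAction
      map_add' := fun M N => by ext; simp [complexAction_apply, Matrix.map_add, Matrix.add_mulVec]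
      map_smul' := fun c M => by
        ext
        simp [complexAction_apply, Matrix.smul_mulVec, Matrix.map_smul] }

theorem locallyIntegrableOn_complexAction {X : Type*} [TopologicalSpace X] [T2Space X]
    [LocallyCompactSpace X] [MeasurableSpace X] {μ : Measure X} {Ω : Set X} (hΩ : IsOpen Ω)
    {A : X → Matrix (Fin m) (Fin m) ℝ}
    (hA : ∀ i j, LocallyIntegrableOn (fun x => A x i j) Ω μ) :
    LocallyIntegrableOn (fun x => complexAction (A x)) Ω μ :=
  (locallyIntegrableOn_iff hΩ.isLocallyClosed).mpr fun _ hKΩ hK =>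
    integrable_complexAction fun i j => (hA i j).integrableOn_compact_subset hKΩ hK

theorem continuous_pderiv {u : EuclideanSpace ℝ (Fin n) → EuclideanSpace ℂ (Fin m)}
    (hu : ContDiff ℝ 1 u) (k : Fin n) : Continuous (pderiv k u) :=
  (hu.continuous_fderiv one_ne_zero).clm_apply continuous_const

theorem pderiv_eq_zero_of_notMem_tsupport
    {u : EuclideanSpace ℝ (Fin n) → EuclideanSpace ℂ (Fin m)} {x : EuclideanSpace ℝ (Fin n)}
    (hx : x ∉ tsupport u) (k : Fin n) : pderiv k u x = 0 := by
  rw [pderiv, fderiv_of_notMem_tsupport ℝ hx, zero_apply]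

theorem pderiv_congr {u v : EuclideanSpace ℝ (Fin n) → EuclideanSpace ℂ (Fin m)}
    {x : EuclideanSpace ℝ (Fin n)} (huv : u =ᶠ[𝓝 x] v) (k : Fin n) :
    pderiv k u x = pderiv k v x := by
  rw [pderiv, huv.fderiv_eq, pderiv]

/-- The real part of the integrand in the definition of `L^Φ`-dissipativity, for a diagonal system
with coefficients `T k` and a general pair of functions in the place of `u` and `φ(|u|) u`. -/
def energyDensity
    (T : Fin n → EuclideanSpace ℝ (Fin n) → EuclideanSpace ℂ (Fin m) →L[ℝ] EuclideanSpace ℂ (Fin m))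
    (u v : EuclideanSpace ℝ (Fin n) → EuclideanSpace ℂ (Fin m)) (x : EuclideanSpace ℝ (Fin n)) :
    ℝ :=
  ∑ k, inner ℝ (pderiv k v x) (T k x (pderiv k u x))

variable {Ω : Set (EuclideanSpace ℝ (Fin n))}
  {T : Fin n → EuclideanSpace ℝ (Fin n) → EuclideanSpace ℂ (Fin m) →L[ℝ] EuclideanSpace ℂ (Fin m)}
  {u v : EuclideanSpace ℝ (Fin n) → EuclideanSpace ℂ (Fin m)}

theorem IsTest.integrableOn_sum_inner_pderiv (𝕜 : Type*) [RCLike 𝕜]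
    [InnerProductSpace 𝕜 (EuclideanSpace ℂ (Fin m))] (hu : IsTest Ω u) (hv : IsTest Ω v)
    (hT : ∀ k, LocallyIntegrableOn (T k) Ω) :
    IntegrableOn (fun x => ∑ k, inner 𝕜 (pderiv k v x) (T k x (pderiv k u x))) Ω := by
  refine integrable_finsetSum _ fun k _ => Integrable.integrableOn ?_
  refine (integrableOn_iff_integrable_of_support_subset (s := tsupport u) fun x hx => ?_).mp
    (integrableOn_inner_clm_apply hu.2.1 ((hT k).integrableOn_compact_subset hu.2.2 hu.2.1)
      (continuous_pderiv hv.1 k).continuousOn (continuous_pderiv hu.1 k).continuousOn)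
  by_contra hxu
  exact hx (by simp [pderiv_eq_zero_of_notMem_tsupport hxu])

/-- `L^Φ`-dissipativity of the diagonal system whose coefficients are the real-linear operators
`T k`. -/
def IsDiagDissipative (φ : ℝ → ℝ) (Ω : Set (EuclideanSpace ℝ (Fin n)))
    (T : Fin n → EuclideanSpace ℝ (Fin n) →
      EuclideanSpace ℂ (Fin m) →L[ℝ] EuclideanSpace ℂ (Fin m)) : Prop :=
  ∀ u, IsTest Ω u → IsTest Ω (phiMul φ u) → 0 ≤ ∫ x in Ω, energyDensity T u (phiMul φ u) x

theorem sum_inner_diagCoeff (A : Fin n → EuclideanSpace ℝ (Fin n) → Matrix (Fin m) (Fin m) ℝ)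
    (u v : EuclideanSpace ℝ (Fin n) → EuclideanSpace ℂ (Fin m)) (x : EuclideanSpace ℝ (Fin n)) :
    ∑ h, ∑ k, inner ℂ (pderiv h v x)
        (WithLp.toLp 2 ((diagCoeff A h k x).mulVec (WithLp.ofLp (pderiv k u x)))) =
      ∑ h, inner ℂ (pderiv h v x) (complexAction (A h x) (pderiv h u x)) := by
  refine Finset.sum_congr rfl fun h _ => ?_
  rw [Finset.sum_eq_single h]
  · simp [diagCoeff, complexAction_apply]
  · intro k _ hk
    simp [diagCoeff, hk.symm]
  · simp

theorem lPhiDissipative_diagCoeff_iff_isDiagDissipative {φ : ℝ → ℝ}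
    {A : Fin n → EuclideanSpace ℝ (Fin n) → Matrix (Fin m) (Fin m) ℝ}
    (hA : ∀ k, LocallyIntegrableOn (fun x => complexAction (A k x)) Ω) :
    LPhiDissipative φ Ω (diagCoeff A) ↔
      IsDiagDissipative φ Ω (fun k x => complexAction (A k x)) := by
  refine forall_congr' fun u => forall₂_congr fun hu hv => ?_
  simp only [sum_inner_diagCoeff]
  have hre := integral_re (IsTest.integrableOn_sum_inner_pderiv ℂ hu hv hA)
  rw [← RCLike.re_eq_complex_re, ← hre]
  simp only [RCLike.re_eq_complex_re, Complex.re_sum, re_inner_complex_eq_inner_real,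
    energyDensity]

end EnergyDensity

section Sufficiency

theorem inner_fderiv_nonneg_of_forall_inner_nonneg {E F : Type*} [NormedAddCommGroup E]
    [NormedSpace ℝ E] [NormedAddCommGroup F] [InnerProductSpace ℝ F] {u v : E → F} {x : E}
    (hu : DifferentiableAt ℝ u x) (hv : DifferentiableAt ℝ v x) (hux : u x = 0) (hvx : v x = 0)
    (S : F →L[ℝ] F) (hS : ∀ y, 0 ≤ (inner ℝ (v y) (S (u y)) : ℝ)) (e : E) :
    0 ≤ (inner ℝ (fderiv ℝ v x e) (S (fderiv ℝ u x e)) : ℝ) := by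
  have hlim := (hv.hasFDerivAt.hasLineDerivAt e).tendsto_slope_zero_right.inner (𝕜 := ℝ)
    ((S.continuous.tendsto _).comp (hu.hasFDerivAt.hasLineDerivAt e).tendsto_slope_zero_right)
  refine ge_of_tendsto hlim ?_
  filter_upwards [self_mem_nhdsWithin] with t ht
  have ht' : 0 < t⁻¹ := inv_pos.mpr ht
  simp only [Function.comp_apply, hux, hvx, sub_zero, map_smul, real_inner_smul_left,
    real_inner_smul_right]
  exact mul_nonneg ht'.le (mul_nonneg ht'.le (hS _))

theorem IsRadialWeight.inner_radialMap_nonneg {F : Type*} [NormedAddCommGroup F]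
    [InnerProductSpace ℝ F] {φ : ℝ → ℝ} (hφ : IsRadialWeight φ) {S : F → F}
    (hS : ∀ y, 0 ≤ (inner ℝ y (S y) : ℝ)) (y : F) : 0 ≤ (inner ℝ (radialMap φ y) (S y) : ℝ) := by
  rcases eq_or_ne y 0 with rfl | hy
  · simp [radialMap]
  · rw [radialMap, real_inner_smul_left]
    exact mul_nonneg (hφ.pos _ (norm_pos_iff.mpr hy)).le (hS y)

variable {n m : ℕ} {φ : ℝ → ℝ}

/-- The vector `z = iξ` is orthogonal to `ξ` over the reals, so only the `φ(|z|) ξ` term of the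
derivative of the radial map survives. -/
theorem IsRadiallyAccretive.inner_nonneg {S : EuclideanSpace ℂ (Fin m) → EuclideanSpace ℂ (Fin m)}
    (hS : IsRadiallyAccretive φ S) (hφ : IsRadialWeight φ) (ξ : EuclideanSpace ℂ (Fin m)) :
    0 ≤ (inner ℝ ξ (S ξ) : ℝ) := by
  rcases eq_or_ne ξ 0 with rfl | hξ
  · simp
  have hz : Complex.I • ξ ≠ 0 := smul_ne_zero Complex.I_ne_zero hξ
  have horth : inner ℝ (Complex.I • ξ) ξ = (0 : ℝ) := by
    rw [← re_inner_complex_eq_inner_real, inner_smul_left, inner_self_eq_norm_sq_to_K]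
    simp [← Complex.ofReal_pow]
  have h := hS _ hz ξ
  have hnorm := norm_pos_iff.mpr hz
  have hpos := hφ.pos _ hnorm
  rw [hφ.inner_fderiv_radialMap hz, horth, zero_mul, mul_zero, add_zero] at h
  exact nonneg_of_mul_nonneg_right (nonneg_of_mul_nonneg_right h (by positivity)) (by positivity)

theorem IsRadialWeight.pderiv_phiMul (hφ : IsRadialWeight φ)
    {u : EuclideanSpace ℝ (Fin n) → EuclideanSpace ℂ (Fin m)} {x : EuclideanSpace ℝ (Fin n)}
    (hu : DifferentiableAt ℝ u x) (hux : u x ≠ 0) (k : Fin n) :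
    pderiv k (phiMul φ u) x = fderiv ℝ (radialMap φ) (u x) (pderiv k u x) := by
  have hΨ := (hφ.contDiffAt_radialMap hux).differentiableAt one_ne_zero
  exact DFunLike.congr_fun (fderiv_comp x hΨ hu) (EuclideanSpace.single k 1)

theorem IsRadialWeight.energyDensity_phiMul_nonneg (hφ : IsRadialWeight φ)
    {T : Fin n → EuclideanSpace ℝ (Fin n) → EuclideanSpace ℂ (Fin m) →L[ℝ] EuclideanSpace ℂ (Fin m)}
    {u : EuclideanSpace ℝ (Fin n) → EuclideanSpace ℂ (Fin m)} {x : EuclideanSpace ℝ (Fin n)}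
    (hu : DifferentiableAt ℝ u x) (hv : DifferentiableAt ℝ (phiMul φ u) x)
    (hT : ∀ k, IsRadiallyAccretive φ (T k x)) : 0 ≤ energyDensity T u (phiMul φ u) x := by
  refine Finset.sum_nonneg fun k _ => ?_
  rcases eq_or_ne (u x) 0 with hux | hux
  · exact inner_fderiv_nonneg_of_forall_inner_nonneg hu hv hux (by simp [phiMul, hux]) (T k x)
      (fun y => hφ.inner_radialMap_nonneg ((hT k).inner_nonneg hφ) (u y)) _
  · rw [hφ.pderiv_phiMul hu hux]
    exact hT k _ hux _

end Sufficiency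

section Profile

theorem contDiff_comp_sq {g g' : ℝ → ℝ} {C : ℝ} (hg : Continuous g)
    (hderiv : ∀ σ, 0 < σ → HasDerivAt g (g' σ) σ) (hcont : ContinuousOn g' (Ioi 0))
    (hbound : ∀ σ, 0 < σ → |g' σ| ≤ C) : ContDiff ℝ 1 (fun τ => g (τ ^ 2)) := by
  have hd_ne {τ : ℝ} (hτ : τ ≠ 0) : HasDerivAt (fun τ => g (τ ^ 2)) (g' (τ ^ 2) * (2 * τ)) τ := by
    simpa [Function.comp_def] using (hderiv (τ ^ 2) (by positivity)).comp τ (hasDerivAt_pow 2 τ)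
  have hzero : ContinuousAt (fun τ => g' (τ ^ 2) * (2 * τ)) 0 := by
    have hlim : Tendsto (fun τ : ℝ => C * |2 * τ|) (𝓝 0) (𝓝 0) := by
      have : Continuous fun τ : ℝ => C * |2 * τ| := by fun_prop
      simpa using this.tendsto 0
    rw [ContinuousAt, mul_zero, mul_zero]
    refine squeeze_zero_norm (fun τ => ?_) hlim
    rcases eq_or_ne τ 0 with rfl | hτ
    · simp
    · rw [norm_mul, Real.norm_eq_abs, Real.norm_eq_abs]
      gcongr
      exact hbound _ (by positivity)
  have hd (τ : ℝ) : HasDerivAt (fun τ => g (τ ^ 2)) (g' (τ ^ 2) * (2 * τ)) τ :=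
    hasDerivAt_of_hasDerivAt_of_ne' (fun y hy => hd_ne hy) (by fun_prop) hzero τ
  refine contDiff_one_iff_deriv.mpr ⟨fun τ => (hd τ).differentiableAt, ?_⟩
  rw [funext fun τ => (hd τ).deriv, continuous_iff_continuousAt]
  intro τ
  rcases eq_or_ne τ 0 with rfl | hτ
  · exact hzero
  · have hτ' : 0 < τ ^ 2 := by positivity
    exact ((hcont.continuousAt (Ioi_mem_nhds hτ')).comp (f := fun τ : ℝ => τ ^ 2)
      (by fun_prop)).mul (by fun_prop)

theorem exists_continuous_inverse_id_add {f : ℝ → ℝ} (hf : ContinuousOn f (Ici 0)) (hf0 : f 0 = 0)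
    (hmono : MonotoneOn f (Ici 0)) :
    ∃ G : ℝ → ℝ, Continuous G ∧ StrictMono G ∧ (∀ t, 0 ≤ t → G (t + f t) = t) ∧
      ∀ σ, 0 ≤ σ → G σ + f (G σ) = σ := by
  have hpos (t : ℝ) : 0 ≤ f (max t 0) :=
    hf0.symm.trans_le (hmono self_mem_Ici (le_max_right t 0) (le_max_right t 0))
  have hH : Continuous fun t => t + f (max t 0) :=
    continuous_id.add (hf.comp_continuous (by fun_prop) fun t => le_max_right t 0)
  have hstrict : StrictMono fun t => t + f (max t 0) :=
    strictMono_id.add_monotone fun s t hst =>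
      hmono (le_max_right s 0) (le_max_right t 0) (max_le_max_right 0 hst)
  have hsurj : Function.Surjective fun t => t + f (max t 0) := by
    refine hH.surjective (tendsto_atTop_mono (fun t => le_add_of_nonneg_right (hpos t)) tendsto_id)
      (tendsto_id.congr' ?_)
    filter_upwards [eventually_le_atBot 0] with t ht
    simp [ht, hf0]
  let e := hstrict.orderIsoOfSurjective _ hsurj
  have he {t : ℝ} (ht : 0 ≤ t) : e t = t + f t := by
    change t + f (max t 0) = t + f t
    rw [max_eq_left ht]
  have he0 : e.symm 0 = 0 := by rw [OrderIso.symm_apply_eq, he le_rfl, hf0, add_zero]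
  refine ⟨e.symm, e.symm.continuous, e.symm.strictMono,
    fun t ht => by rw [← he ht, e.symm_apply_apply], fun σ hσ => ?_⟩
  rw [← he (he0.symm.trans_le (e.symm.monotone hσ)), e.apply_symm_apply]

theorem contDiff_inverse_id_add_comp_sq {f G : ℝ → ℝ} (hf : ContDiffOn ℝ 1 f (Ioi 0))
    (hderiv : ∀ t, 0 < t → 0 ≤ deriv f t) (hG : Continuous G) (hGpos : ∀ σ, 0 < σ → 0 < G σ)
    (hinv : ∀ σ, 0 ≤ σ → G σ + f (G σ) = σ) : ContDiff ℝ 1 (fun τ => G (τ ^ 2)) := by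
  have hden {σ : ℝ} (hσ : 0 < σ) : 1 ≤ 1 + deriv f (G σ) := by linarith [hderiv _ (hGpos σ hσ)]
  refine contDiff_comp_sq (g' := fun σ => (1 + deriv f (G σ))⁻¹) (C := 1) hG (fun σ hσ => ?_) ?_
    fun σ hσ => ?_
  · have hfG : HasDerivAt f (deriv f (G σ)) (G σ) :=
      (hf.differentiableOn one_ne_zero).hasDerivAt (Ioi_mem_nhds (hGpos σ hσ))
    refine ((hasDerivAt_id _).add hfG).of_local_left_inverse hG.continuousAt
      (by linarith [hden hσ]) ?_
    filter_upwards [Ioi_mem_nhds hσ] with t ht using hinv t (le_of_lt ht)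
  · refine ContinuousOn.inv₀ (continuousOn_const.add
      ((hf.continuousOn_deriv_of_isOpen isOpen_Ioi le_rfl).comp hG.continuousOn hGpos))
      fun σ hσ => ?_
    linarith [hden hσ]
  · rw [abs_of_nonneg (inv_nonneg.mpr (by linarith [hden hσ]))]
    exact inv_le_one_of_one_le₀ (hden hσ)

variable {φ : ℝ → ℝ} {s : ℝ}

theorem IsRadialWeight.continuousOn_mul_self (hφ : IsRadialWeight φ) :
    ContinuousOn (fun s => s * φ s) (Ici 0) := by
  intro s hs
  rcases (mem_Ici.mp hs).eq_or_lt with rfl | hs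
  · rw [← Ioi_insert, continuousWithinAt_insert_self, ContinuousWithinAt, zero_mul]
    exact hφ.tendsto_mul_self
  · exact (hφ.hasDerivAt_mul_self hs).continuousAt.continuousWithinAt

/-- Both `γ` and `γ φ(γ)` are `C¹` for `γ τ = G (τ ^ 2)`, where `G` inverts `t + t φ(t)`: the
derivative of `G` lies in `(0, 1]`, and `γ φ(γ) = τ ^ 2 - γ`. -/
theorem IsRadialWeight.exists_contDiff_profile (hφ : IsRadialWeight φ) (hs : 0 < s) :
    ∃ γ : ℝ → ℝ, ContDiff ℝ 1 γ ∧ ContDiff ℝ 1 (fun τ => γ τ * φ (γ τ)) ∧ γ 0 = 0 ∧ γ 1 = s ∧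
      ∀ τ, 0 ≤ γ τ := by
  have hderiv (t : ℝ) (ht : 0 < t) : 0 ≤ deriv (fun t => t * φ t) t := (hφ.deriv_pos t ht).le
  obtain ⟨G, hG, hGmono, hleft, hright⟩ := exists_continuous_inverse_id_add
    hφ.continuousOn_mul_self (zero_mul _) (monotoneOn_of_deriv_nonneg (convex_Ici 0)
      hφ.continuousOn_mul_self (by
        rw [interior_Ici]
        exact fun t ht => (hφ.hasDerivAt_mul_self ht).differentiableAt.differentiableWithinAt)
      (by rwa [interior_Ici]))
  have hG0 : G 0 = 0 := by simpa using hleft 0 le_rfl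
  have hGpos (σ : ℝ) (hσ : 0 < σ) : 0 < G σ := hG0 ▸ hGmono hσ
  have hγ := (contDiff_inverse_id_add_comp_sq (contDiffOn_id.mul hφ.contDiffOn) hderiv hG hGpos
    hright).comp (contDiff_id.const_smul √(s + s * φ s))
  refine ⟨fun τ => G ((√(s + s * φ s) * τ) ^ 2), hγ, ?_, by simp [hG0], ?_, fun τ => ?_⟩
  · have hsq : ContDiff ℝ 1 fun τ => (√(s + s * φ s) * τ) ^ 2 := by fun_prop
    convert hsq.sub hγ using 2 with τ
    exact eq_sub_of_add_eq' (hright _ (sq_nonneg _))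
  · have hsum : 0 ≤ s + s * φ s := by have := hφ.pos s hs; positivity
    simp only [mul_one, Real.sq_sqrt hsum, hleft s hs.le]
  · exact hG0 ▸ hGmono.monotone (sq_nonneg _)

end Profile

section TestFunctions

theorem exists_contDiff_tsupport_subset_eq_one_iff {E : Type*} [NormedAddCommGroup E]
    [NormedSpace ℝ E] [FiniteDimensional ℝ E] {K Ω : Set E} (hK : IsCompact K) (hΩ : IsOpen Ω)
    (hKΩ : K ⊆ Ω) :
    ∃ g : E → ℝ, ContDiff ℝ 1 g ∧ HasCompactSupport g ∧ tsupport g ⊆ Ω ∧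
      (∀ x, g x ∈ Icc 0 1) ∧ ∀ x, g x = 1 ↔ x ∈ K := by
  obtain ⟨L, hL, hKL, hLΩ⟩ := exists_compact_between hK hΩ hKΩ
  obtain ⟨g, hg, hrange, hsupp, hone⟩ := exists_contMDiff_support_eq_eq_one_iff (n := 1)
    (modelWithCornersSelf ℝ E) isOpen_interior hK.isClosed hKL
  have htsupp : tsupport g ⊆ L :=
    closure_minimal (hsupp.trans_subset interior_subset) hL.isClosed
  exact ⟨g, hg.contDiff, hL.of_isClosed_subset (isClosed_tsupport g) htsupp, htsupp.trans hLΩ,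
    fun x => hrange (mem_range_self x), fun x => (hone x).symm⟩

variable {n m : ℕ} {φ : ℝ → ℝ} {Ω : Set (EuclideanSpace ℝ (Fin n))}
  {u v w : EuclideanSpace ℝ (Fin n) → EuclideanSpace ℂ (Fin m)} {z : EuclideanSpace ℂ (Fin m)}

theorem IsTest.add (hu : IsTest Ω u) (hw : IsTest Ω w) : IsTest Ω (fun x => u x + w x) :=
  ⟨hu.1.add hw.1, hu.2.1.add hw.2.1, (tsupport_add u w).trans (union_subset hu.2.2 hw.2.2)⟩

theorem IsTest.of_forall_eq_zero (hu : IsTest Ω u) (hv : ContDiff ℝ 1 v)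
    (h : ∀ x, u x = 0 → v x = 0) : IsTest Ω v := by
  have hsupp : Function.support v ⊆ Function.support u := fun x hx hux => hx (h x hux)
  exact ⟨hv, hu.2.1.mono hsupp, (closure_mono hsupp).trans hu.2.2⟩

theorem isTest_comp_smul {g : EuclideanSpace ℝ (Fin n) → ℝ} (hg : ContDiff ℝ 1 g)
    (hgc : HasCompactSupport g) (hgΩ : tsupport g ⊆ Ω) {γ : ℝ → ℝ} (hγ : ContDiff ℝ 1 γ)
    (hγ0 : γ 0 = 0) (ζ : EuclideanSpace ℂ (Fin m)) : IsTest Ω (fun x => γ (g x) • ζ) := by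
  have hsupp : Function.support (fun x => γ (g x) • ζ) ⊆ Function.support g :=
    fun x hx hgx => hx (by simp [hgx, hγ0])
  exact ⟨(hγ.comp hg).smul contDiff_const, hgc.mono hsupp, (closure_mono hsupp).trans hgΩ⟩

theorem IsRadialWeight.exists_isTest_eventuallyEq_const (hφ : IsRadialWeight φ)
    {K : Set (EuclideanSpace ℝ (Fin n))} (hK : IsCompact K) (hΩ : IsOpen Ω) (hKΩ : K ⊆ Ω)
    (hz : z ≠ 0) :
    ∃ u, IsTest Ω u ∧ IsTest Ω (phiMul φ u) ∧ ∀ x ∈ K, u =ᶠ[𝓝 x] fun _ => z := by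
  obtain ⟨L, hL, hKL, hLΩ⟩ := exists_compact_between hK hΩ hKΩ
  obtain ⟨g, hg, hgc, hgΩ, -, hg1⟩ := exists_contDiff_tsupport_subset_eq_one_iff hL hΩ hLΩ
  have hnorm := norm_pos_iff.mpr hz
  obtain ⟨γ, hγ, hγφ, hγ0, hγ1, hγ_nonneg⟩ := hφ.exists_contDiff_profile hnorm
  have hphi : phiMul φ (fun x => γ (g x) • ‖z‖⁻¹ • z) =
      fun x => (γ (g x) * φ (γ (g x))) • ‖z‖⁻¹ • z := by
    funext x
    have hgx : ‖γ (g x) • ‖z‖⁻¹ • z‖ = γ (g x) := by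
      rw [norm_smul, norm_smul, norm_inv, norm_norm, inv_mul_cancel₀ hnorm.ne', mul_one,
        Real.norm_of_nonneg (hγ_nonneg _)]
    rw [phiMul, hgx, smul_smul (φ _), mul_comm]
  refine ⟨fun x => γ (g x) • ‖z‖⁻¹ • z, isTest_comp_smul hg hgc hgΩ hγ hγ0 _,
    hphi ▸ isTest_comp_smul hg hgc hgΩ hγφ (by simp [hγ0]) _, fun x hx => ?_⟩
  filter_upwards [isOpen_interior.mem_nhds (hKL hx)] with y hy
  rw [(hg1 y).mpr (interior_subset hy), hγ1, smul_inv_smul₀ hnorm.ne']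

theorem IsRadialWeight.isTest_phiMul_add (hφ : IsRadialWeight φ) (hu : IsTest Ω u)
    (hv : IsTest Ω (phiMul φ u)) (hw : IsTest Ω w)
    (hconst : ∀ x ∈ tsupport w, u =ᶠ[𝓝 x] fun _ => z) (hsmall : ∀ x, ‖w x‖ < ‖z‖) :
    IsTest Ω (phiMul φ (fun x => u x + w x)) := by
  refine (hu.add hw).of_forall_eq_zero (contDiff_iff_contDiffAt.mpr fun x => ?_)
    fun x hx => by rw [phiMul, hx, smul_zero]
  by_cases hx : x ∈ tsupport w
  · have hne : u x + w x ≠ 0 := fun h => (hsmall x).ne' (by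
      rw [(hconst x hx).eq_of_nhds] at h
      rw [eq_neg_of_add_eq_zero_left h, norm_neg])
    exact ContDiffAt.comp x (g := radialMap φ) (hφ.contDiffAt_radialMap hne)
      (hu.add hw).1.contDiffAt
  · refine hv.1.contDiffAt.congr_of_eventuallyEq ?_
    filter_upwards [notMem_tsupport_iff_eventuallyEq.mp hx] with y hy
    simp only [phiMul, hy, Pi.zero_apply, add_zero]

variable {T : Fin n → EuclideanSpace ℝ (Fin n) →
  EuclideanSpace ℂ (Fin m) →L[ℝ] EuclideanSpace ℂ (Fin m)}

theorem energyDensity_congr {u' v' : EuclideanSpace ℝ (Fin n) → EuclideanSpace ℂ (Fin m)}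
    {x : EuclideanSpace ℝ (Fin n)} (hu : u =ᶠ[𝓝 x] u') (hv : v =ᶠ[𝓝 x] v') :
    energyDensity T u v x = energyDensity T u' v' x := by
  simp only [energyDensity, pderiv_congr hu, pderiv_congr hv]

theorem energyDensity_eq_zero_of_eventuallyEq_const {x : EuclideanSpace ℝ (Fin n)}
    (hu : u =ᶠ[𝓝 x] fun _ => z) : energyDensity T u v x = 0 := by
  simp only [energyDensity, pderiv_congr hu]
  simp [pderiv]

/-- A perturbation supported where `u` is constant decouples from `u`. -/
theorem energyDensity_phiMul_add (hconst : ∀ x ∈ tsupport w, u =ᶠ[𝓝 x] fun _ => z)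
    (x : EuclideanSpace ℝ (Fin n)) :
    energyDensity T (fun x => u x + w x) (phiMul φ (fun x => u x + w x)) x =
      energyDensity T u (phiMul φ u) x +
        energyDensity T (fun x => z + w x) (phiMul φ (fun x => z + w x)) x := by
  by_cases hx : x ∈ tsupport w
  · have hadd : (fun x => u x + w x) =ᶠ[𝓝 x] fun x => z + w x :=
      (hconst x hx).add EventuallyEq.rfl
    rw [energyDensity_eq_zero_of_eventuallyEq_const (hconst x hx), zero_add]
    exact energyDensity_congr hadd (hadd.fun_comp (radialMap φ))
  · have hw := notMem_tsupport_iff_eventuallyEq.mp hx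
    have hadd : (fun x => u x + w x) =ᶠ[𝓝 x] u := hw.mono fun y hy => by simp [hy]
    have hz : (fun x => z + w x) =ᶠ[𝓝 x] fun _ => z := hw.mono fun y hy => by simp [hy]
    rw [energyDensity_eq_zero_of_eventuallyEq_const hz, add_zero]
    exact energyDensity_congr hadd (hadd.fun_comp (radialMap φ))

theorem IsTest.integrableOn_energyDensity (hu : IsTest Ω u) (hv : IsTest Ω v)
    (hT : ∀ k, LocallyIntegrableOn (T k) Ω) : IntegrableOn (energyDensity T u v) Ω :=
  hu.integrableOn_sum_inner_pderiv ℝ hv hT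

theorem IsRadialWeight.integrableOn_energyDensity_const_add (hφ : IsRadialWeight φ)
    (hT : ∀ k, LocallyIntegrableOn (T k) Ω) (hu : IsTest Ω u) (hv : IsTest Ω (phiMul φ u))
    (hw : IsTest Ω w) (hconst : ∀ x ∈ tsupport w, u =ᶠ[𝓝 x] fun _ => z)
    (hsmall : ∀ x, ‖w x‖ < ‖z‖) :
    IntegrableOn (energyDensity T (fun x => z + w x) (phiMul φ (fun x => z + w x))) Ω := by
  have hv' := hφ.isTest_phiMul_add hu hv hw hconst hsmall
  refine (((hu.add hw).integrableOn_energyDensity hv' hT).sub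
    (hu.integrableOn_energyDensity hv hT)).congr (.of_forall fun x => ?_)
  simp only [Pi.sub_apply, energyDensity_phiMul_add hconst, add_sub_cancel_left]

theorem IsRadialWeight.neg_integral_le_integral_energyDensity_const_add (hφ : IsRadialWeight φ)
    (hT : ∀ k, LocallyIntegrableOn (T k) Ω)
    (hdiss : IsDiagDissipative φ Ω T)
    (hu : IsTest Ω u) (hv : IsTest Ω (phiMul φ u)) (hw : IsTest Ω w)
    (hconst : ∀ x ∈ tsupport w, u =ᶠ[𝓝 x] fun _ => z) (hsmall : ∀ x, ‖w x‖ < ‖z‖) :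
    -∫ x in Ω, energyDensity T u (phiMul φ u) x ≤
      ∫ x in Ω, energyDensity T (fun x => z + w x) (phiMul φ (fun x => z + w x)) x := by
  have h := hdiss _ (hu.add hw) (hφ.isTest_phiMul_add hu hv hw hconst hsmall)
  simp only [energyDensity_phiMul_add hconst] at h
  rw [integral_add (hu.integrableOn_energyDensity hv hT)
    (hφ.integrableOn_energyDensity_const_add hT hu hv hw hconst hsmall)] at h
  linarith

end TestFunctions

section Wave

variable {E : Type*} [NormedAddCommGroup E] [NormedSpace ℝ E] {η : E → ℝ} {l : E →L[ℝ] ℝ}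
  {θ c : ℝ} {x : E}

/-- A plane wave with envelope `η` and phase `c² l + θ`. The amplitude tends to `0` as `c → ∞`,
while the derivative grows like `c`. -/
def wave (η : E → ℝ) (l : E →L[ℝ] ℝ) (θ c : ℝ) (x : E) : ℝ :=
  c⁻¹ * (η x * Real.cos (c ^ 2 * l x + θ))

theorem contDiff_wave (hη : ContDiff ℝ 1 η) (l : E →L[ℝ] ℝ) (θ c : ℝ) :
    ContDiff ℝ 1 (wave η l θ c) :=
  contDiff_const.mul
    (hη.mul (Real.contDiff_cos.comp ((contDiff_const.mul l.contDiff).add contDiff_const)))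

theorem abs_wave_le (η : E → ℝ) (l : E →L[ℝ] ℝ) (θ c : ℝ) (x : E) :
    |wave η l θ c x| ≤ |c⁻¹| * |η x| := by
  rw [wave, abs_mul, abs_mul]
  gcongr
  exact mul_le_of_le_one_right (abs_nonneg _) (Real.abs_cos_le_one _)

theorem eventually_forall_norm_wave_smul_lt {F : Type*} [NormedAddCommGroup F] [NormedSpace ℝ F]
    (hη : Continuous η) (hηc : HasCompactSupport η) (l : E →L[ℝ] ℝ) (θ : ℝ) (ξ : F) {ε : ℝ}
    (hε : 0 < ε) : ∀ᶠ c in atTop, ∀ x, ‖wave η l θ c x • ξ‖ < ε := by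
  obtain ⟨C, hC⟩ := hηc.exists_bound_of_continuous hη
  have hlim : Tendsto (fun c : ℝ => |c⁻¹| * C * ‖ξ‖) atTop (𝓝 0) := by
    simpa using (tendsto_inv_atTop_zero.abs.mul_const C).mul_const ‖ξ‖
  filter_upwards [hlim.eventually_lt_const hε] with c hc x
  calc ‖wave η l θ c x • ξ‖ ≤ |c⁻¹| * |η x| * ‖ξ‖ := by
        rw [norm_smul, Real.norm_eq_abs]
        gcongr
        exact abs_wave_le η l θ c x
    _ ≤ |c⁻¹| * C * ‖ξ‖ := by
        gcongr
        exact hC x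
    _ < ε := hc

theorem tendsto_wave (η : E → ℝ) (l : E →L[ℝ] ℝ) (θ : ℝ) (x : E) :
    Tendsto (fun c => wave η l θ c x) atTop (𝓝 0) :=
  squeeze_zero_norm (fun c => abs_wave_le η l θ c x)
    (by simpa using tendsto_inv_atTop_zero.abs.mul_const |η x|)

theorem inv_mul_fderiv_wave (hη : DifferentiableAt ℝ η x) (hc : c ≠ 0) (v : E) :
    c⁻¹ * fderiv ℝ (wave η l θ c) x v =
      c⁻¹ ^ 2 * fderiv ℝ η x v * Real.cos (c ^ 2 * l x + θ) -
        η x * l v * Real.sin (c ^ 2 * l x + θ) := by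
  have hcos := ((l.hasFDerivAt.const_mul (c ^ 2)).add_const θ).cos (x := x)
  have h := (hη.hasFDerivAt.mul hcos).const_mul c⁻¹
  rw [show fderiv ℝ (wave η l θ c) x = _ from h.fderiv]
  simp only [smul_apply, add_apply, smul_eq_mul]
  field_simp
  ring

theorem abs_inv_mul_fderiv_wave_le (hη : DifferentiableAt ℝ η x) (hc : 1 ≤ c) (v : E) :
    |c⁻¹ * fderiv ℝ (wave η l θ c) x v| ≤ |fderiv ℝ η x v| + |η x * l v| := by
  have hc0 : 0 < c := one_pos.trans_le hc
  rw [inv_mul_fderiv_wave hη hc0.ne', mul_assoc]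
  refine (abs_sub _ _).trans (add_le_add ?_ ?_)
  · rw [abs_mul, abs_mul, abs_of_nonneg (sq_nonneg _)]
    exact (mul_le_of_le_one_left (by positivity)
      (pow_le_one₀ (by positivity) (inv_le_one_of_one_le₀ hc))).trans
      (mul_le_of_le_one_right (abs_nonneg _) (Real.abs_cos_le_one _))
  · rw [abs_mul]
    exact mul_le_of_le_one_right (abs_nonneg _) (Real.abs_sin_le_one _)

/-- Two waves in phase quadrature: the squares of their derivatives add up without oscillating. -/
theorem tendsto_sq_fderiv_wave_add_sq_fderiv_wave (hη : DifferentiableAt ℝ η x) (v : E) :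
    Tendsto (fun c => (c⁻¹ * fderiv ℝ (wave η l 0 c) x v) ^ 2 +
      (c⁻¹ * fderiv ℝ (wave η l (Real.pi / 2) c) x v) ^ 2) atTop (𝓝 ((η x * l v) ^ 2)) := by
  have hlim : Tendsto (fun c : ℝ => (c⁻¹ ^ 2 * fderiv ℝ η x v) ^ 2 + (η x * l v) ^ 2) atTop
      (𝓝 ((η x * l v) ^ 2)) := by
    simpa using (((tendsto_inv_atTop_zero.pow 2).mul_const (fderiv ℝ η x v)).pow 2).add_const
      ((η x * l v) ^ 2)
  refine hlim.congr' ?_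
  filter_upwards [eventually_ne_atTop 0] with c hc
  rw [inv_mul_fderiv_wave hη hc, inv_mul_fderiv_wave hη hc, Real.cos_add_pi_div_two,
    Real.sin_add_pi_div_two, add_zero]
  linear_combination (-(c⁻¹ ^ 2 * fderiv ℝ η x v) ^ 2 - (η x * l v) ^ 2) *
    Real.sin_sq_add_cos_sq (c ^ 2 * l x)

theorem tendsto_mul_add_mul_of_tendsto_add {ι : Type*} {f : Filter ι} {a₀ a₁ q₀ q₁ : ι → ℝ}
    {s q : ℝ} (ha₀ : ∀ i, 0 ≤ a₀ i) (ha₁ : ∀ i, 0 ≤ a₁ i)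
    (hs : Tendsto (fun i => a₀ i + a₁ i) f (𝓝 s)) (h₀ : Tendsto q₀ f (𝓝 q))
    (h₁ : Tendsto q₁ f (𝓝 q)) :
    Tendsto (fun i => a₀ i * q₀ i + a₁ i * q₁ i) f (𝓝 (s * q)) := by
  have key (a p : ι → ℝ) (hle : ∀ i, |a i| ≤ a₀ i + a₁ i) (hp : Tendsto p f (𝓝 q)) :
      Tendsto (fun i => a i * (p i - q)) f (𝓝 0) := by
    refine squeeze_zero_norm (fun i => ?_) (by simpa using hs.mul (hp.sub_const q).abs)
    rw [norm_mul]
    exact mul_le_mul_of_nonneg_right (hle i) (abs_nonneg _)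
  have h := ((key a₀ q₀ (fun i => by rw [abs_of_nonneg (ha₀ i)]; linarith [ha₁ i]) h₀).add
    (key a₁ q₁ (fun i => by rw [abs_of_nonneg (ha₁ i)]; linarith [ha₀ i]) h₁)).add
    (hs.mul_const q)
  rw [zero_add, zero_add] at h
  exact h.congr fun i => by ring

end Wave

section HighFrequency

variable {n m : ℕ} {φ : ℝ → ℝ} {Ω : Set (EuclideanSpace ℝ (Fin n))}
  {T : Fin n → EuclideanSpace ℝ (Fin n) →
    EuclideanSpace ℂ (Fin m) →L[ℝ] EuclideanSpace ℂ (Fin m)}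
  {η : EuclideanSpace ℝ (Fin n) → ℝ} {l : EuclideanSpace ℝ (Fin n) →L[ℝ] ℝ} {θ c : ℝ}
  {x : EuclideanSpace ℝ (Fin n)} {z ξ : EuclideanSpace ℂ (Fin m)}

theorem tsupport_wave_smul_subset : tsupport (fun x => wave η l θ c x • ξ) ⊆ tsupport η :=
  closure_mono fun x hx hηx => hx (by simp [wave, hηx])

theorem isTest_wave_smul (hη : ContDiff ℝ 1 η) (hηc : HasCompactSupport η) (hηΩ : tsupport η ⊆ Ω) :
    IsTest Ω (fun x => wave η l θ c x • ξ) :=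
  ⟨(contDiff_wave hη l θ c).smul contDiff_const,
    hηc.of_isClosed_subset (isClosed_tsupport _) tsupport_wave_smul_subset,
    tsupport_wave_smul_subset.trans hηΩ⟩

theorem IsRadialWeight.energyDensity_const_add_smul (hφ : IsRadialWeight φ)
    {a : EuclideanSpace ℝ (Fin n) → ℝ} (ha : DifferentiableAt ℝ a x) (hne : z + a x • ξ ≠ 0) :
    energyDensity T (fun x => z + a x • ξ) (phiMul φ (fun x => z + a x • ξ)) x =
      ∑ k, fderiv ℝ a x (EuclideanSpace.single k 1) ^ 2 *
        inner ℝ (fderiv ℝ (radialMap φ) (z + a x • ξ) ξ) (T k x ξ) := by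
  have hu : HasFDerivAt (fun x => z + a x • ξ) ((fderiv ℝ a x).smulRight ξ) x :=
    (ha.hasFDerivAt.smul_const ξ).const_add z
  refine Finset.sum_congr rfl fun k _ => ?_
  rw [hφ.pderiv_phiMul hu.differentiableAt hne, pderiv, hu.fderiv,
    ContinuousLinearMap.smulRight_apply, map_smul, map_smul, real_inner_smul_left,
    real_inner_smul_right, sq, mul_assoc]

/-- The energy density of the plane wave `wave η l θ c • ξ` around the constant `z`, rescaled so
that it stays bounded as `c → ∞`. -/
def waveDensity (φ : ℝ → ℝ)
    (T : Fin n → EuclideanSpace ℝ (Fin n) →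
      EuclideanSpace ℂ (Fin m) →L[ℝ] EuclideanSpace ℂ (Fin m))
    (η : EuclideanSpace ℝ (Fin n) → ℝ) (l : EuclideanSpace ℝ (Fin n) →L[ℝ] ℝ)
    (z ξ : EuclideanSpace ℂ (Fin m)) (θ c : ℝ) (x : EuclideanSpace ℝ (Fin n)) : ℝ :=
  c⁻¹ ^ 2 *
    energyDensity T (fun x => z + wave η l θ c x • ξ) (phiMul φ (fun x => z + wave η l θ c x • ξ)) x

theorem IsRadialWeight.waveDensity_eq_sum (hφ : IsRadialWeight φ) (hη : DifferentiableAt ℝ η x)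
    (hne : z + wave η l θ c x • ξ ≠ 0) :
    waveDensity φ T η l z ξ θ c x =
      ∑ k, (c⁻¹ * fderiv ℝ (wave η l θ c) x (EuclideanSpace.single k 1)) ^ 2 *
        inner ℝ (fderiv ℝ (radialMap φ) (z + wave η l θ c x • ξ) ξ) (T k x ξ) := by
  have hwave : DifferentiableAt ℝ (wave η l θ c) x := by unfold wave; fun_prop
  rw [waveDensity, hφ.energyDensity_const_add_smul hwave hne, Finset.mul_sum]
  exact Finset.sum_congr rfl fun k _ => by rw [mul_pow, mul_assoc]

theorem IsRadialWeight.tendsto_waveDensity_add (hφ : IsRadialWeight φ)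
    (hη : DifferentiableAt ℝ η x) (l : EuclideanSpace ℝ (Fin n) →L[ℝ] ℝ) (hz : z ≠ 0)
    (ξ : EuclideanSpace ℂ (Fin m)) :
    Tendsto (fun c => waveDensity φ T η l z ξ 0 c x + waveDensity φ T η l z ξ (Real.pi / 2) c x)
      atTop (𝓝 (∑ k, (η x * l (EuclideanSpace.single k 1)) ^ 2 *
        inner ℝ (fderiv ℝ (radialMap φ) z ξ) (T k x ξ))) := by
  have hpoint (θ : ℝ) : Tendsto (fun c => z + wave η l θ c x • ξ) atTop (𝓝 z) := by
    simpa using ((tendsto_wave η l θ x).smul_const ξ).const_add z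
  have hform (k : Fin n) : ContinuousAt
      (fun y => (inner ℝ (fderiv ℝ (radialMap φ) y ξ) (T k x ξ) : ℝ)) z :=
    (((hφ.contDiffAt_radialMap hz).continuousAt_fderiv one_ne_zero).clm_apply
      continuousAt_const).inner continuousAt_const
  refine (tendsto_finsetSum Finset.univ fun k _ => tendsto_mul_add_mul_of_tendsto_add
    (fun _ => sq_nonneg _) (fun _ => sq_nonneg _)
    (tendsto_sq_fderiv_wave_add_sq_fderiv_wave hη (EuclideanSpace.single k 1))
    ((hform k).tendsto.comp (hpoint 0)) ((hform k).tendsto.comp (hpoint (Real.pi / 2)))).congr' ?_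
  filter_upwards [(hpoint 0).eventually_ne hz, (hpoint (Real.pi / 2)).eventually_ne hz]
    with c h₀ h₁
  rw [hφ.waveDensity_eq_sum hη h₀, hφ.waveDensity_eq_sum hη h₁, Finset.sum_add_distrib]
  rfl

theorem IsRadialWeight.exists_forall_norm_lt_norm_fderiv_radialMap_add_le
    (hφ : IsRadialWeight φ) (hz : z ≠ 0) :
    ∃ δ > 0, δ ≤ ‖z‖ ∧ ∃ M, ∀ y, ‖y‖ < δ → ‖fderiv ℝ (radialMap φ) (z + y)‖ ≤ M := by
  have hcont := (hφ.contDiffAt_radialMap hz).continuousAt_fderiv one_ne_zero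
  obtain ⟨δ, hδ, hball⟩ := Metric.eventually_nhds_iff.mp
    (hcont.norm.eventually_lt_const (lt_add_one _))
  refine ⟨min δ ‖z‖, lt_min hδ (norm_pos_iff.mpr hz), min_le_right _ _, _, fun y hy =>
    (hball ?_).le⟩
  simpa [dist_eq_norm] using hy.trans_le (min_le_left _ _)

theorem IsRadialWeight.abs_waveDensity_le (hφ : IsRadialWeight φ) (hη : DifferentiableAt ℝ η x)
    (hc : 1 ≤ c) (hne : z + wave η l θ c x • ξ ≠ 0) {M : ℝ}
    (hM : ‖fderiv ℝ (radialMap φ) (z + wave η l θ c x • ξ)‖ ≤ M) :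
    |waveDensity φ T η l z ξ θ c x| ≤
      ∑ k, (|fderiv ℝ η x (EuclideanSpace.single k 1)| +
        |η x * l (EuclideanSpace.single k 1)|) ^ 2 * (M * ‖ξ‖ ^ 2 * ‖T k x‖) := by
  have hM0 := (norm_nonneg _).trans hM
  rw [hφ.waveDensity_eq_sum hη hne]
  refine (Finset.abs_sum_le_sum_abs _ _).trans (Finset.sum_le_sum fun k _ => ?_)
  rw [abs_mul, abs_pow]
  gcongr
  · exact abs_inv_mul_fderiv_wave_le hη hc _
  · calc |inner ℝ (fderiv ℝ (radialMap φ) (z + wave η l θ c x • ξ) ξ) (T k x ξ)|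
        ≤ ‖fderiv ℝ (radialMap φ) (z + wave η l θ c x • ξ) ξ‖ * ‖T k x ξ‖ :=
          abs_real_inner_le_norm _ _
      _ ≤ (M * ‖ξ‖) * (‖T k x‖ * ‖ξ‖) := by
          gcongr
          · exact ContinuousLinearMap.le_of_opNorm_le _ hM ξ
          · exact (T k x).le_opNorm ξ
      _ = M * ‖ξ‖ ^ 2 * ‖T k x‖ := by ring

theorem integrableOn_sum_sq_mul_norm (hT : ∀ k, LocallyIntegrableOn (T k) Ω)
    (hη : ContDiff ℝ 1 η) (hηc : HasCompactSupport η) (hηΩ : tsupport η ⊆ Ω)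
    (l : EuclideanSpace ℝ (Fin n) →L[ℝ] ℝ) (C : ℝ) :
    IntegrableOn (fun x => ∑ k, (|fderiv ℝ η x (EuclideanSpace.single k 1)| +
      |η x * l (EuclideanSpace.single k 1)|) ^ 2 * (C * ‖T k x‖)) Ω := by
  have := hη.continuous_fderiv one_ne_zero
  have := hη.continuous
  refine integrable_finsetSum _ fun k _ => Integrable.integrableOn ?_
  refine (integrableOn_iff_integrable_of_support_subset (s := tsupport η) fun x hx => ?_).mp
    (IntegrableOn.continuousOn_mul (Continuous.continuousOn (by fun_prop))
      (((hT k).integrableOn_compact_subset hηΩ hηc).norm.const_mul C) hηc)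
  by_contra hxη
  exact hx (by simp [fderiv_of_notMem_tsupport ℝ hxη, image_eq_zero_of_notMem_tsupport hxη])

theorem IsRadialWeight.tendsto_integral_waveDensity_add (hφ : IsRadialWeight φ)
    (hT : ∀ k, LocallyIntegrableOn (T k) Ω) (hη : ContDiff ℝ 1 η) (hηc : HasCompactSupport η)
    (hηΩ : tsupport η ⊆ Ω) (l : EuclideanSpace ℝ (Fin n) →L[ℝ] ℝ) (hz : z ≠ 0)
    (hint : ∀ θ, ∀ᶠ c in atTop, IntegrableOn (waveDensity φ T η l z ξ θ c) Ω) :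
    Tendsto (fun c => ∫ x in Ω, (waveDensity φ T η l z ξ 0 c x +
      waveDensity φ T η l z ξ (Real.pi / 2) c x)) atTop
      (𝓝 (∫ x in Ω, ∑ k, (η x * l (EuclideanSpace.single k 1)) ^ 2 *
        inner ℝ (fderiv ℝ (radialMap φ) z ξ) (T k x ξ))) := by
  obtain ⟨δ, hδ, hδz, M, hM⟩ := hφ.exists_forall_norm_lt_norm_fderiv_radialMap_add_le hz
  have hη' := hη.differentiable one_ne_zero
  have hbound (θ : ℝ) : ∀ᶠ c in atTop, ∀ x, |waveDensity φ T η l z ξ θ c x| ≤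
      ∑ k, (|fderiv ℝ η x (EuclideanSpace.single k 1)| +
        |η x * l (EuclideanSpace.single k 1)|) ^ 2 * (M * ‖ξ‖ ^ 2 * ‖T k x‖) := by
    filter_upwards [eventually_forall_norm_wave_smul_lt hη.continuous hηc l θ ξ hδ,
      eventually_ge_atTop 1] with c hsmall hc x
    refine hφ.abs_waveDensity_le (hη' x) hc (fun h => ?_) (hM _ (hsmall x))
    exact ((hsmall x).trans_le hδz).ne (by rw [eq_neg_of_add_eq_zero_left h, norm_neg])
  have hdom := integrableOn_sum_sq_mul_norm hT hη hηc hηΩ l (M * ‖ξ‖ ^ 2)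
  refine tendsto_integral_filter_of_dominated_convergence _ ?_ ?_ (hdom.add hdom)
    (.of_forall fun x => hφ.tendsto_waveDensity_add (hη' x) l hz ξ)
  · filter_upwards [hint 0, hint (Real.pi / 2)] with c h₀ h₁
    exact (h₀.add h₁).aestronglyMeasurable
  · filter_upwards [hbound 0, hbound (Real.pi / 2)] with c h₀ h₁
    exact .of_forall fun x => (abs_add_le _ _).trans (add_le_add (h₀ x) (h₁ x))

theorem IsRadialWeight.integral_sum_sq_mul_inner_nonneg (hφ : IsRadialWeight φ) (hΩ : IsOpen Ω)
    (hT : ∀ k, LocallyIntegrableOn (T k) Ω)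
    (hdiss : IsDiagDissipative φ Ω T)
    (hη : ContDiff ℝ 1 η) (hηc : HasCompactSupport η) (hηΩ : tsupport η ⊆ Ω)
    (l : EuclideanSpace ℝ (Fin n) →L[ℝ] ℝ) (hz : z ≠ 0) (ξ : EuclideanSpace ℂ (Fin m)) :
    0 ≤ ∫ x in Ω, ∑ k, (η x * l (EuclideanSpace.single k 1)) ^ 2 *
      inner ℝ (fderiv ℝ (radialMap φ) z ξ) (T k x ξ) := by
  obtain ⟨u, hu, hv, hconst⟩ := hφ.exists_isTest_eventuallyEq_const hηc hΩ hηΩ hz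
  have hconst' (θ c : ℝ) : ∀ x ∈ tsupport (fun x => wave η l θ c x • ξ), u =ᶠ[𝓝 x] fun _ => z :=
    fun x hx => hconst x (tsupport_wave_smul_subset hx)
  have hsmall (θ : ℝ) :=
    eventually_forall_norm_wave_smul_lt hη.continuous hηc l θ ξ (norm_pos_iff.mpr hz)
  have hint (θ : ℝ) : ∀ᶠ c in atTop, IntegrableOn (waveDensity φ T η l z ξ θ c) Ω :=
    (hsmall θ).mono fun c hc => (hφ.integrableOn_energyDensity_const_add hT hu hv
      (isTest_wave_smul hη hηc hηΩ) (hconst' θ c) hc).const_mul _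
  have hlower (θ : ℝ) : ∀ᶠ c in atTop,
      c⁻¹ ^ 2 * -(∫ x in Ω, energyDensity T u (phiMul φ u) x) ≤
        ∫ x in Ω, waveDensity φ T η l z ξ θ c x :=
    (hsmall θ).mono fun c hc => by
      simp only [waveDensity, integral_const_mul]
      exact mul_le_mul_of_nonneg_left (hφ.neg_integral_le_integral_energyDensity_const_add hT hdiss
        hu hv (isTest_wave_smul hη hηc hηΩ) (hconst' θ c) hc) (sq_nonneg _)
  have hzero : Tendsto (fun c : ℝ => c⁻¹ ^ 2 * -(∫ x in Ω, energyDensity T u (phiMul φ u) x) +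
      c⁻¹ ^ 2 * -(∫ x in Ω, energyDensity T u (phiMul φ u) x)) atTop (𝓝 0) := by
    have h := (tendsto_inv_atTop_zero (𝕜 := ℝ).pow 2).mul_const
      (-(∫ x in Ω, energyDensity T u (phiMul φ u) x))
    simpa using h.add h
  refine le_of_tendsto_of_tendsto hzero
    (hφ.tendsto_integral_waveDensity_add hT hη hηc hηΩ l hz hint) ?_
  filter_upwards [hlower 0, hlower (Real.pi / 2), hint 0, hint (Real.pi / 2)] with c h₀ h₁ i₀ i₁
  rw [integral_add i₀ i₁]
  exact add_le_add h₀ h₁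

theorem IsRadialWeight.integral_sq_mul_inner_nonneg (hφ : IsRadialWeight φ) (hΩ : IsOpen Ω)
    (hT : ∀ k, LocallyIntegrableOn (T k) Ω)
    (hdiss : IsDiagDissipative φ Ω T)
    (hη : ContDiff ℝ 1 η) (hηc : HasCompactSupport η) (hηΩ : tsupport η ⊆ Ω) (hz : z ≠ 0)
    (ξ : EuclideanSpace ℂ (Fin m)) (h : Fin n) :
    0 ≤ ∫ x in Ω, η x ^ 2 * inner ℝ (fderiv ℝ (radialMap φ) z ξ) (T h x ξ) := by
  simpa [Pi.single_apply, mul_pow, ite_pow] using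
    hφ.integral_sum_sq_mul_inner_nonneg hΩ hT hdiss hη hηc hηΩ (EuclideanSpace.proj h) hz ξ

end HighFrequency

section Localization

theorem setIntegral_nonneg_of_forall_integral_sq_mul_nonneg {E : Type*} [NormedAddCommGroup E]
    [NormedSpace ℝ E] [FiniteDimensional ℝ E] [MeasurableSpace E] [BorelSpace E] {μ : Measure E}
    {Ω K : Set E} (hΩ : IsOpen Ω) {q : E → ℝ} (hq : LocallyIntegrableOn q Ω μ)
    (h : ∀ η : E → ℝ, ContDiff ℝ 1 η → HasCompactSupport η → tsupport η ⊆ Ω →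
      0 ≤ ∫ x in Ω, η x ^ 2 * q x ∂μ)
    (hK : IsCompact K) (hKΩ : K ⊆ Ω) : 0 ≤ ∫ x in K, q x ∂μ := by
  obtain ⟨g, hg, hgc, hgΩ, hrange, hone⟩ :=
    exists_contDiff_tsupport_subset_eq_one_iff hK hΩ hKΩ
  have hlim : Tendsto (fun j : ℕ => ∫ x in Ω, (g x ^ (j + 1)) ^ 2 * q x ∂μ) atTop
      (𝓝 (∫ x in Ω, K.indicator q x ∂μ)) := by
    refine tendsto_integral_of_dominated_convergence ((tsupport g).indicator fun x => ‖q x‖)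
      (fun j => ((hg.continuous.pow _).pow 2).aestronglyMeasurable.mul hq.aestronglyMeasurable)
      ?_ (fun j => .of_forall fun x => ?_) (.of_forall fun x => ?_)
    · exact ((integrable_indicator_iff (isClosed_tsupport g).measurableSet).mpr
        (hq.integrableOn_compact_subset hgΩ hgc).norm).integrableOn
    · by_cases hx : x ∈ tsupport g
      · rw [indicator_of_mem hx, norm_mul, norm_pow, norm_pow, Real.norm_of_nonneg (hrange x).1]
        exact mul_le_of_le_one_left (norm_nonneg _) (pow_le_one₀ (pow_nonneg (hrange x).1 _)
          (pow_le_one₀ (hrange x).1 (hrange x).2))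
      · simp [hx, image_eq_zero_of_notMem_tsupport hx]
    · by_cases hx : x ∈ K
      · simp [hx, (hone x).mpr hx]
      · have hlt : g x < 1 := (hrange x).2.lt_of_ne fun hgx => hx ((hone x).mp hgx)
        have hpow := (tendsto_add_atTop_iff_nat 1).mpr
          (tendsto_pow_atTop_nhds_zero_of_lt_one (hrange x).1 hlt)
        simpa [hx] using (hpow.pow 2).mul_const (q x)
  rw [setIntegral_indicator hK.measurableSet, inter_eq_right.mpr hKΩ] at hlim
  refine ge_of_tendsto' hlim fun j => ?_
  have hsupp : Function.support (fun x => g x ^ (j + 1)) = Function.support g :=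
    Function.support_pow' g j.succ_ne_zero
  exact h _ (hg.pow _) (hgc.mono hsupp.subset) ((congrArg closure hsupp).trans_subset hgΩ)

theorem ae_nonneg_of_forall_setIntegral_isCompact_nonneg {E : Type*} [MetricSpace E]
    [SecondCountableTopology E] [MeasurableSpace E] [BorelSpace E] {μ : Measure E}
    [μ.InnerRegular] {Ω : Set E} (hΩ : IsOpen Ω) {q : E → ℝ} (hq : LocallyIntegrableOn q Ω μ)
    (h : ∀ K, IsCompact K → K ⊆ Ω → 0 ≤ ∫ x in K, q x ∂μ) :
    ∀ᵐ x ∂μ.restrict Ω, 0 ≤ q x := by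
  have hm : AEStronglyMeasurable q (μ.restrict Ω) := hq.aestronglyMeasurable
  have hmk : q =ᵐ[μ.restrict Ω] hm.mk q := hm.ae_eq_mk
  have hneg : MeasurableSet {x | hm.mk q x < 0} :=
    measurableSet_lt hm.stronglyMeasurable_mk.measurable measurable_const
  suffices hnull : μ.restrict Ω {x | hm.mk q x < 0} = 0 by
    filter_upwards [hmk, measure_eq_zero_iff_ae_notMem.mp hnull] with x hx hx'
    rw [hx]
    exact not_lt.mp hx'
  rw [Measure.restrict_apply hneg]
  by_contra hne
  obtain ⟨K, hKsub, hK, hKpos⟩ :=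
    (hneg.inter hΩ.measurableSet).exists_lt_isCompact (pos_iff_ne_zero.mpr hne)
  have hKΩ : K ⊆ Ω := hKsub.trans inter_subset_right
  have hqK : ∀ᵐ x ∂μ.restrict K, q x < 0 := by
    filter_upwards [ae_restrict_of_ae_restrict_of_subset hKΩ hmk,
      ae_restrict_mem hK.measurableSet] with x hx hxK
    exact hx.trans_lt (hKsub hxK).1
  refine (h K hK hKΩ).not_gt (neg_pos.mp ?_)
  rw [← integral_neg, integral_pos_iff_support_of_nonneg_ae
    (hqK.mono fun x hx => neg_nonneg.mpr hx.le) (hq.integrableOn_compact_subset hKΩ hK).neg]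
  have hsupp : Function.support (fun x => -q x) =ᵐ[μ.restrict K] univ :=
    eventuallyEq_univ.mpr (hqK.mono fun x hx => neg_ne_zero.mpr hx.ne)
  rwa [measure_congr hsupp, Measure.restrict_apply_univ]

theorem ae_forall_nonneg_of_forall_ae_nonneg {X Y : Type*} [MeasurableSpace X] {μ : Measure X}
    [TopologicalSpace Y] [TopologicalSpace.SeparableSpace Y] {f : X → Y → ℝ}
    (hf : ∀ x, Continuous (f x)) (h : ∀ y, ∀ᵐ x ∂μ, 0 ≤ f x y) : ∀ᵐ x ∂μ, ∀ y, 0 ≤ f x y := by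
  rcases isEmpty_or_nonempty Y with hY | hY
  · exact .of_forall fun x y => hY.elim y
  filter_upwards [ae_all_iff.mpr fun i => h (TopologicalSpace.denseSeq Y i)] with x hx
  exact isClosed_property (TopologicalSpace.denseRange_denseSeq Y)
    (isClosed_le continuous_const (hf x)) hx

end Localization

section PointwiseCriterion

variable {n m : ℕ} {φ : ℝ → ℝ} {Ω : Set (EuclideanSpace ℝ (Fin n))}
  {T : Fin n → EuclideanSpace ℝ (Fin n) →
    EuclideanSpace ℂ (Fin m) →L[ℝ] EuclideanSpace ℂ (Fin m)}

theorem IsDiagDissipative.ae_inner_fderiv_nonneg (hdiss : IsDiagDissipative φ Ω T)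
    (hφ : IsRadialWeight φ) (hΩ : IsOpen Ω) (hT : ∀ k, LocallyIntegrableOn (T k) Ω) (h : Fin n)
    {z : EuclideanSpace ℂ (Fin m)} (hz : z ≠ 0) (ξ : EuclideanSpace ℂ (Fin m)) :
    ∀ᵐ x ∂volume.restrict Ω, 0 ≤ (inner ℝ (fderiv ℝ (radialMap φ) z ξ) (T h x ξ) : ℝ) := by
  have hloc : LocallyIntegrableOn
      (fun x => (inner ℝ (fderiv ℝ (radialMap φ) z ξ) (T h x ξ) : ℝ)) Ω :=
    (locallyIntegrableOn_iff hΩ.isLocallyClosed).mpr fun K hKΩ hK =>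
      integrableOn_inner_clm_apply hK ((hT h).integrableOn_compact_subset hKΩ hK)
        continuousOn_const continuousOn_const
  exact ae_nonneg_of_forall_setIntegral_isCompact_nonneg hΩ hloc fun K hK hKΩ =>
    setIntegral_nonneg_of_forall_integral_sq_mul_nonneg hΩ hloc (fun η hη hηc hηΩ =>
      hφ.integral_sq_mul_inner_nonneg hΩ hT hdiss hη hηc hηΩ hz ξ h) hK hKΩ

theorem IsRadialWeight.isDiagDissipative_iff (hφ : IsRadialWeight φ) (hΩ : IsOpen Ω)
    (hT : ∀ k, LocallyIntegrableOn (T k) Ω) :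
    IsDiagDissipative φ Ω T ↔ ∀ h, ∀ᵐ x ∂volume.restrict Ω, IsRadiallyAccretive φ (T h x) := by
  constructor
  · intro hdiss h
    have hcont (x : EuclideanSpace ℝ (Fin n)) :
        Continuous fun p : {z : EuclideanSpace ℂ (Fin m) // z ≠ 0} × EuclideanSpace ℂ (Fin m) =>
          (inner ℝ (fderiv ℝ (radialMap φ) p.1.1 p.2) (T h x p.2) : ℝ) := by
      have hfderiv : Continuous fun z : {z : EuclideanSpace ℂ (Fin m) // z ≠ 0} =>
          fderiv ℝ (radialMap φ) z.1 :=
        continuous_iff_continuousAt.mpr fun z =>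
          ((hφ.contDiffAt_radialMap z.2).continuousAt_fderiv one_ne_zero).comp
            continuousAt_subtype_val
      exact ((hfderiv.comp continuous_fst).clm_apply continuous_snd).inner
        ((T h x).continuous.comp continuous_snd)
    filter_upwards [ae_forall_nonneg_of_forall_ae_nonneg hcont fun p =>
      hdiss.ae_inner_fderiv_nonneg hφ hΩ hT h p.1.2 p.2] with x hx z hz ξ
    exact hx (⟨z, hz⟩, ξ)
  · intro hT' u hu hv
    refine integral_nonneg_of_ae ?_
    filter_upwards [ae_all_iff.mpr hT'] with x hx
    exact hφ.energyDensity_phiMul_nonneg (hu.1.differentiable one_ne_zero x)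
      (hv.1.differentiable one_ne_zero x) hx

end PointwiseCriterion

end FunctionalDissipativity

end

theorem mainTheorem7_general (n m : ℕ) (hm : 1 ≤ m)
    (φ : ℝ → ℝ) (hφ : FunctionalDissipativity.IsRadialWeight φ) (κ : ℝ)
    (hκ : IsLUB ((fun s => FunctionalDissipativity.radialLam φ s ^ 2) '' Ioi 0) κ)
    (Ω : Set (EuclideanSpace ℝ (Fin n))) (hΩ_open : IsOpen Ω)
    (A : Fin n → EuclideanSpace ℝ (Fin n) → Matrix (Fin m) (Fin m) ℝ)
    (hA_loc : ∀ h i j, LocallyIntegrableOn (fun x => A h x i j) Ω volume)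
    (hA_symm : ∀ h, ∀ᵐ x ∂(volume.restrict Ω), (A h x).IsSymm)
    (hA_pos : ∀ h, ∀ᵐ x ∂(volume.restrict Ω),
      ∀ ξ : Fin m → ℝ, ξ ≠ 0 → 0 < dotProduct ((A h x).mulVec ξ) ξ) :
    (FunctionalDissipativity.LPhiDissipative φ Ω (FunctionalDissipativity.diagCoeff A) ↔
      ∀ h, ∀ᵐ x ∂(volume.restrict Ω),
        κ * (FunctionalDissipativity.minEigenvalue (A h x) +
            FunctionalDissipativity.maxEigenvalue (A h x)) ^ 2 ≤
          4 * FunctionalDissipativity.minEigenvalue (A h x) *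
            FunctionalDissipativity.maxEigenvalue (A h x)) ∧
    (m = 2 →
      ((∀ h, ∀ᵐ x ∂(volume.restrict Ω),
        κ * (FunctionalDissipativity.minEigenvalue (A h x) +
            FunctionalDissipativity.maxEigenvalue (A h x)) ^ 2 ≤
          4 * FunctionalDissipativity.minEigenvalue (A h x) *
            FunctionalDissipativity.maxEigenvalue (A h x)) ↔
      ∀ h, ∀ᵐ x ∂(volume.restrict Ω),
        κ * (A h x).trace ^ 2 ≤ 4 * (A h x).det)) := by
  have : NeZero m := ⟨Nat.one_le_iff_ne_zero.mp hm⟩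
  have hT (k : Fin n) :=
    FunctionalDissipativity.locallyIntegrableOn_complexAction hΩ_open (hA_loc k)
  constructor
  · rw [FunctionalDissipativity.lPhiDissipative_diagCoeff_iff_isDiagDissipative hT,
      hφ.isDiagDissipative_iff hΩ_open hT]
    refine forall_congr' fun h => eventually_congr ?_
    filter_upwards [hA_symm h, hA_pos h] with x hsymm hpos
    exact FunctionalDissipativity.isRadiallyAccretive_complexAction_iff hφ hκ hsymm hpos
  · rintro rfl
    refine forall_congr' fun h => eventually_congr ?_
    filter_upwards [hA_symm h] with x hsymm
    rw [FunctionalDissipativity.trace_eq_minEigenvalue_add_maxEigenvalue hsymm,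
      FunctionalDissipativity.det_eq_minEigenvalue_mul_maxEigenvalue hsymm, mul_assoc]

theorem mainTheorem7 (n m : ℕ) (hm : 1 ≤ m)
    (φ : ℝ → ℝ) (hφ : FunctionalDissipativity.Admissible φ)
    (Ω : Set (EuclideanSpace ℝ (Fin n))) (hΩ_open : IsOpen Ω) (hΩ_conn : IsConnected Ω)
    (A : Fin n → EuclideanSpace ℝ (Fin n) → Matrix (Fin m) (Fin m) ℝ)
    (hA_loc : ∀ h i j, LocallyIntegrableOn (fun x => A h x i j) Ω volume)
    (hA_symm : ∀ h, ∀ᵐ x ∂(volume.restrict Ω), (A h x).IsSymm)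
    (hA_pos : ∀ h, ∀ᵐ x ∂(volume.restrict Ω),
      ∀ ξ : Fin m → ℝ, ξ ≠ 0 → 0 < dotProduct ((A h x).mulVec ξ) ξ) :
    (FunctionalDissipativity.LPhiDissipative φ Ω (FunctionalDissipativity.diagCoeff A) ↔
      ∀ h, ∀ᵐ x ∂(volume.restrict Ω),
        FunctionalDissipativity.LamInf φ ^ 2 *
            (FunctionalDissipativity.minEigenvalue (A h x) +
              FunctionalDissipativity.maxEigenvalue (A h x)) ^ 2 ≤
          4 * FunctionalDissipativity.minEigenvalue (A h x) *
            FunctionalDissipativity.maxEigenvalue (A h x)) ∧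
    (m = 2 →
      ((∀ h, ∀ᵐ x ∂(volume.restrict Ω),
        FunctionalDissipativity.LamInf φ ^ 2 *
            (FunctionalDissipativity.minEigenvalue (A h x) +
              FunctionalDissipativity.maxEigenvalue (A h x)) ^ 2 ≤
          4 * FunctionalDissipativity.minEigenvalue (A h x) *
            FunctionalDissipativity.maxEigenvalue (A h x)) ↔
      ∀ h, ∀ᵐ x ∂(volume.restrict Ω),
        FunctionalDissipativity.LamInf φ ^ 2 * (A h x).trace ^ 2 ≤ 4 * (A h x).det)) :=
  mainTheorem7_general n m hm φ hφ.isRadialWeight (FunctionalDissipativity.LamInf φ ^ 2)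
    hφ.isLUB_radialLam_sq Ω hΩ_open A hA_loc hA_symm hA_pos
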